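/- Let $f:[0,\infty)\to\mathbb R$ be not almost everywhere zero, and suppose that $W(x,y)=f(x)f(y)\mathbf 1[x\neq y]$ is a graphex, that is, $W:[0,\infty)^2\to[0,1]$ is measurable and symmetric and, with $\mu_W(x)=\int_0^\infty W(x,y)\,dy$ and $|\cdot|$ Lebesgue measure: $|\{\mu_W=\infty\}|=0$, $|\{\mu_W>1\}|<\infty$, $\iint W(x,y)\mathbf 1[\mu_W(x)\le 1]\mathbf 1[\mu_W(y)\le 1]\,dx\,dy<\infty$ and $\int W(x,x)\,dx<\infty$. Let $\{(\theta_i,\vartheta_i)\}_{i\in\mathbb N}$ be (a measurable enumeration of) a unit rate Poisson process on $[0,\infty)^2$ and let $(\zeta_{\{i,j\}})$, indexed by the unordered pairs $\{i,j\}$ (with $i=j$ allowed), be independent random variables that are uniform on $[0,1]$ and independent of $(\theta_i,\vartheta_i)_{i}$. For $\nu\ge 0$ let $G_\nu$ be the $\nu$-truncation of the Kallenberg exchangeable graph associated with $W$: its edges are the pairs $\{\theta_i,\theta_j\}$ with $\theta_i,\theta_j\le\nu$ and $W(\vartheta_i,\vartheta_j)>\zeta_{\{i,j\}}$, and its vertex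 set $v(G_\nu)$ consists of the labels $\theta_i$ that take part in at least one of these edges. Let $C_1(G_\nu)$ be the largest connected component of $G_\nu$. Then for every $\epsilon>0$, $$\lim_{\nu\to\infty}P\bigl(|v(G_\nu)|<\infty\ \text{ and }\ |C_1(G_\nu)|>(1-\epsilon)\,|v(G_\nu)|\bigr)=1 .$$ -/

import Mathlib

open MeasureTheory ProbabilityTheory Filter Topology
open scoped NNReal ENNReal

namespace KEG

/-- Lebesgue measure on the half-line `[0, ∞)`. -/
noncomputable def leb : Measure ℝ≥0 := (volume : Measure ℝ).comap ((↑) : ℝ≥0 → ℝ)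

instance : SigmaFinite leb := by
  have he : MeasurableEmbedding ((↑) : ℝ≥0 → ℝ) :=
    MeasurableEmbedding.subtype_coe measurableSet_Ici
  refine SigmaFinite.of_map leb he.measurable.aemeasurable ?_
  rw [leb, he.map_comap]
  infer_instance

/-- Lebesgue measure on the quadrant `[0, ∞)²`. -/
noncomputable def leb2 : Measure (ℝ≥0 × ℝ≥0) := leb.prod leb

/-- The graphex marginal `μ_W(x) = ∫ W(x, y) dy`, with values in `[0, ∞]`. -/
noncomputable def marginal (W : ℝ≥0 → ℝ≥0 → ℝ) (x : ℝ≥0) : ℝ≥0∞ :=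
  ∫⁻ y, ENNReal.ofReal (W x y) ∂leb

/-- `W : [0, ∞)² → [0, 1]` is (the third component of) a graphex `(0, 0, W)`: it is measurable and
symmetric, and satisfies the local finiteness conditions. -/
structure IsGraphex (W : ℝ≥0 → ℝ≥0 → ℝ) : Prop where
  measurable : Measurable (fun p : ℝ≥0 × ℝ≥0 => W p.1 p.2)
  mem_Icc : ∀ x y, W x y ∈ Set.Icc (0 : ℝ) 1
  symm : ∀ x y, W x y = W y x
  marginal_top : leb {x | marginal W x = ⊤} = 0
  marginal_gt_one : leb {x | 1 < marginal W x} < ⊤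
  integral_small :
    ∫⁻ x in {x | marginal W x ≤ 1}, ∫⁻ y in {y | marginal W y ≤ 1},
      ENNReal.ofReal (W x y) ∂leb ∂leb < ⊤
  integral_diag : ∫⁻ x, ENNReal.ofReal (W x x) ∂leb < ⊤

open Classical in
/-- The separable kernel `W(x, y) = f(x) f(y) 1[x ≠ y]`. -/
noncomputable def separable (f : ℝ≥0 → ℝ) (x y : ℝ≥0) : ℝ :=
  if x = y then 0 else f x * f y

/-- The number of points in `A` of a sequence of points, counted with multiplicity. -/
noncomputable def count {E : Type*} (p : ℕ → E) (A : Set E) : ℕ∞ :=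
  {i | p i ∈ A}.encard

/-- The random points `X 0, X 1, …` enumerate a Poisson process with intensity measure `m`:
the number of points in a measurable set `A` of finite measure has the Poisson law of mean `m A`,
and the numbers of points in finitely many disjoint such sets are independent. -/
structure IsPoissonProcess {Ω E : Type*} [MeasurableSpace Ω] [MeasurableSpace E]
    (X : ℕ → Ω → E) (m : Measure E) (P : Measure Ω) : Prop where
  measurable : ∀ i, Measurable (X i)
  hasLaw : ∀ A : Set E, MeasurableSet A → m A < ⊤ →
    HasLaw (fun ω => count (fun i => X i ω) A)
      ((poissonMeasure (m A).toNNReal).map ((↑) : ℕ → ℕ∞)) P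
  indep : ∀ (n : ℕ) (A : Fin n → Set E), (∀ k, MeasurableSet (A k)) → (∀ k, m (A k) < ⊤) →
    (∀ k l, k ≠ l → Disjoint (A k) (A l)) →
    iIndepFun (fun k ω => count (fun i => X i ω) (A k)) P

/-- The randomness of a Kallenberg exchangeable graph: a unit rate Poisson process
`(θ_i, ϑ_i)` on the quadrant, and an independent family, indexed by the unordered pairs `{i, j}`
(`i = j` allowed), of i.i.d. variables that are uniform on `[0, 1]`. -/
structure IsLatent {Ω : Type*} [MeasurableSpace Ω] (X : ℕ → Ω → ℝ≥0 × ℝ≥0)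
    (ζ : Sym2 ℕ → Ω → ℝ) (P : Measure Ω) : Prop where
  poisson : IsPoissonProcess X leb2 P
  measurable : ∀ e, Measurable (ζ e)
  uniform : ∀ e, HasLaw (ζ e) (volume.restrict (Set.Icc (0 : ℝ) 1)) P
  iIndep : iIndepFun ζ P
  indep : IndepFun (fun ω i => X i ω) (fun ω e => ζ e ω) P

/-- The pair of labels `(a, b)` is an edge of the truncation `G_ν` of the graph with
latent points `x i = (θ_i, ϑ_i)` and edge variables `z`: both labels are at most `ν`, and
they are the labels of points `i`, `j` with `W(ϑ_i, ϑ_j) > z_{i, j}`. -/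
def IsEdge (W : ℝ≥0 → ℝ≥0 → ℝ) (x : ℕ → ℝ≥0 × ℝ≥0) (z : Sym2 ℕ → ℝ) (ν a b : ℝ≥0) : Prop :=
  a ≤ ν ∧ b ≤ ν ∧ ∃ i j, (x i).1 = a ∧ (x j).1 = b ∧ z s(i, j) < W (x i).2 (x j).2

/-- The vertices of `G_ν`: the labels that take part in at least one edge of `G_ν`. -/
def vertexSet (W : ℝ≥0 → ℝ≥0 → ℝ) (x : ℕ → ℝ≥0 × ℝ≥0) (z : Sym2 ℕ → ℝ) (ν : ℝ≥0) : Set ℝ≥0 :=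
  {a | ∃ b, IsEdge W x z ν a b}

/-- The truncation `G_ν` as a graph on its vertex set. Self edges, which do not affect
connectivity, are dropped. -/
def graph (W : ℝ≥0 → ℝ≥0 → ℝ) (x : ℕ → ℝ≥0 × ℝ≥0) (z : Sym2 ℕ → ℝ) (ν : ℝ≥0) :
    SimpleGraph (vertexSet W x z ν) :=
  SimpleGraph.fromRel (fun a b => IsEdge W x z ν a b)

/-- The number of vertices of the largest connected component of a graph. -/
noncomputable def largestComponentSize {V : Type*} (G : SimpleGraph V) : ℕ∞ :=
  ⨆ C : G.ConnectedComponent, C.supp.encard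

end KEG

/-! Since $W\ge 0$, $f(a)f(b)=|f(a)||f(b)|$ for $a\ne b$, and the marginal is $|f(x)|\int|f|$; its
finiteness almost everywhere forces $f$ to be integrable. Given the Poisson points, $G_\nu$ is thus
a rank-one random graph with weights $g_i=|f(\vartheta_i)|$, set to $0$ for labels beyond $\nu$. Fix
a small $\delta$ and call the points with $g_i\ge\delta$ the core. Every third core point is a
common neighbour of two given ones with probability at least $\delta^4$, so a large core lies in one
component with high probability (`measure_not_coreLinked_le`).

Any other vertex is attached (adjacent to the core) or stray. Let $S$ be the weight of the core and
$O$ the weight outside it. A point of weight $g$ outside the core is attached with probability at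
least $1-e^{-gS}$ and stray with probability at most $e^{-gS}gO$. If $O\le\eta S$, then $te^{-t}\le
1-e^{-t}$ at $t=gS$ bounds the second by $\eta$ times the first, so strays are few compared with
attached points, whatever the number of vertices is. Markov's inequality for the strays and
Chebyshev's for the attached points turn this into a high-probability statement
(`measure_not_typical_le`).

Integrability of $f$ and Campbell's formula make $O\le\eta S$ likely for small $\delta$, and the
Poisson lower tail makes the core large (`measure_not_goodPoints_le`). Independence of points and
edge variables combines the two (`measure_not_giant_le`). -/

namespace KEG

/-! ### Core, attached and stray points of a weighted random graph -/

/-- Adjacency of the indices `i` and `j` in the random graph with vertex weights `g` and edge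
variables `z`. -/
def Adj (g : ℕ → ℝ) (z : Sym2 ℕ → ℝ) (i j : ℕ) : Prop :=
  i ≠ j ∧ z s(i, j) < g i * g j

/-- The indices of weight at least `δ`. -/
def core (g : ℕ → ℝ) (δ : ℝ) : Set ℕ := {i | δ ≤ g i}

/-- The indices outside the core that are adjacent to the core. -/
def attached (g : ℕ → ℝ) (δ : ℝ) (z : Sym2 ℕ → ℝ) : Set ℕ :=
  {i | i ∉ core g δ ∧ ∃ j ∈ core g δ, Adj g z i j}

/-- The non-isolated indices that are neither in the core nor adjacent to it. -/
def stray (g : ℕ → ℝ) (δ : ℝ) (z : Sym2 ℕ → ℝ) : Set ℕ :=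
  {i | i ∉ core g δ ∧ (∀ j ∈ core g δ, ¬ Adj g z i j) ∧ ∃ j, Adj g z i j}

/-- Any two indices of the core have a common neighbour in the core. -/
def CoreLinked (g : ℕ → ℝ) (δ : ℝ) (z : Sym2 ℕ → ℝ) : Prop :=
  ∀ i ∈ core g δ, ∀ j ∈ core g δ, i ≠ j → ∃ k ∈ core g δ, Adj g z i k ∧ Adj g z j k

/-- The core is well connected, finitely many indices are attached to it, and there are few stray
indices. -/
def Typical (g : ℕ → ℝ) (δ ε : ℝ) (z : Sym2 ℕ → ℝ) : Prop :=
  CoreLinked g δ z ∧ ((attached g δ z).encard : ℝ≥0∞) < ⊤ ∧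
    ((stray g δ z).encard : ℝ≥0∞) ≤
      ENNReal.ofReal ε * (((core g δ).encard : ℝ≥0∞) + ((attached g δ z).encard : ℝ≥0∞))

lemma Adj.symm {g : ℕ → ℝ} {z : Sym2 ℕ → ℝ} {i j : ℕ} (h : Adj g z i j) : Adj g z j i := by
  refine ⟨h.1.symm, ?_⟩
  rw [Sym2.eq_swap, mul_comm]
  exact h.2

open Classical in
/-- The weight `|f(ϑ)|` of the latent point `(θ, ϑ)`, set to `0` for labels beyond `ν`. -/
noncomputable def weight (f : ℝ≥0 → ℝ) (ν : ℝ≥0) (p : ℝ≥0 × ℝ≥0) : ℝ :=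
  if p.1 ≤ ν then |f p.2| else 0

lemma weight_nonneg (f : ℝ≥0 → ℝ) (ν : ℝ≥0) (p : ℝ≥0 × ℝ≥0) : 0 ≤ weight f ν p := by
  unfold weight; split_ifs <;> simp

/-! ### Deterministic part: a typical configuration has a giant component -/

section Graph

variable {f : ℝ≥0 → ℝ} {x : ℕ → ℝ≥0 × ℝ≥0} {z : Sym2 ℕ → ℝ} {ν : ℝ≥0}

/-- The cutoff at `ν` is absorbed by the zero weights, since `z ≥ 0` excludes edges of probability
zero. For the same reason there are no self edges. -/
lemma isEdge_iff_adj (hff : ∀ a b, a ≠ b → 0 ≤ f a * f b)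
    (hx2 : Function.Injective fun i => (x i).2) (hz : ∀ e, 0 ≤ z e) (a b : ℝ≥0) :
    IsEdge (separable f) x z ν a b ↔
      ∃ i j, (x i).1 = a ∧ (x j).1 = b ∧ Adj (fun i => weight f ν (x i)) z i j := by
  constructor
  · rintro ⟨ha, hb, i, j, hi, hj, hlt⟩
    refine ⟨i, j, hi, hj, ?_⟩
    have hW : 0 < separable f (x i).2 (x j).2 := (hz _).trans_lt hlt
    have hij : (x i).2 ≠ (x j).2 := by
      intro h
      simp [separable, h] at hW
    refine ⟨fun h => hij (by rw [h]), ?_⟩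
    simp only [separable, hij, if_false] at hlt
    simpa [weight, hi, hj, ha, hb, ← abs_mul, abs_of_nonneg (hff _ _ hij)] using hlt
  · rintro ⟨i, j, hi, hj, hne, hlt⟩
    have hW := (hz _).trans_lt hlt
    have ha : (x i).1 ≤ ν := by
      by_contra h
      simp [weight, h] at hW
    have hb : (x j).1 ≤ ν := by
      by_contra h
      simp [weight, h] at hW
    refine ⟨hi ▸ ha, hj ▸ hb, i, j, hi, hj, ?_⟩
    have hij : (x i).2 ≠ (x j).2 := fun h => hne (hx2 h)
    simpa [separable, hij, weight, ha, hb, ← abs_mul, abs_of_nonneg (hff _ _ hij)] using hlt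

/-- Core and attached points lie in one component, and only strays can be outside it. -/
theorem giant_of_typical (hff : ∀ a b, a ≠ b → 0 ≤ f a * f b)
    (hx1 : Function.Injective fun i => (x i).1)
    (hx2 : Function.Injective fun i => (x i).2) (hz : ∀ e, 0 ≤ z e) {δ ε : ℝ} (hε : 0 < ε)
    (hcore : (core (fun i => weight f ν (x i)) δ).Finite)
    (hcard : 2 ≤ (core (fun i => weight f ν (x i)) δ).ncard)
    (ht : Typical (fun i => weight f ν (x i)) δ ε z) :
    (vertexSet (separable f) x z ν).Finite ∧
      (1 - ε) * ((vertexSet (separable f) x z ν).ncard : ℝ) <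
        ((largestComponentSize (graph (separable f) x z ν)).toNat : ℝ) := by
  set g : ℕ → ℝ := fun i => weight f ν (x i) with hg
  have hE := isEdge_iff_adj (ν := ν) hff hx2 hz
  set K := core g δ
  set T := attached g δ z
  set B := stray g δ z
  set V := vertexSet (separable f) x z ν
  obtain ⟨hlink, hT, hB⟩ := ht
  have hTf : T.Finite := by
    rw [← Set.encard_lt_top_iff]
    simpa using hT
  have hBf : B.Finite := by
    rw [← Set.encard_lt_top_iff]
    have : (B.encard : ℝ≥0∞) < ⊤ := by
      refine hB.trans_lt (ENNReal.mul_lt_top ENNReal.ofReal_lt_top (ENNReal.add_lt_top.2 ⟨?_, hT⟩))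
      simpa using hcore.encard_lt_top
    simpa using this
  have hBn : (B.ncard : ℝ) ≤ ε * (K.ncard + T.ncard) := by
    rw [← hBf.cast_ncard_eq, ← hTf.cast_ncard_eq, ← hcore.cast_ncard_eq] at hB
    simp only [ENat.toENNReal_coe] at hB
    have := ENNReal.toReal_mono (by finiteness) hB
    simpa [ENNReal.toReal_add, hε.le] using this
  have hVsub : V ⊆ (fun i => (x i).1) '' (K ∪ T ∪ B) := by
    rintro a ⟨b, hab⟩
    obtain ⟨i, j, hi, hj, hadj⟩ := (hE a b).1 hab
    refine ⟨i, ?_, hi⟩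
    by_cases h1 : i ∈ K
    · exact Or.inl (Or.inl h1)
    by_cases h2 : ∃ j ∈ K, Adj g z i j
    · exact Or.inl (Or.inr ⟨h1, h2⟩)
    · push Not at h2
      exact Or.inr ⟨h1, h2, j, hadj⟩
  have hfin : (K ∪ T ∪ B).Finite := (hcore.union hTf).union hBf
  have hVf : V.Finite := (hfin.image _).subset hVsub
  have hVn : V.ncard ≤ K.ncard + T.ncard + B.ncard :=
    (Set.ncard_le_ncard hVsub (hfin.image _)).trans <| (Set.ncard_image_le hfin).trans <|
      (Set.ncard_union_le _ _).trans (by gcongr; exact Set.ncard_union_le _ _)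
  refine ⟨hVf, ?_⟩
  -- A single core point could be isolated and so not be a vertex; a second core point supplies an
  -- edge through the common neighbour.
  have hexists : ∀ i ∈ K, ∃ k ∈ K, Adj g z i k := by
    intro i hi
    obtain ⟨j, hj, hne⟩ := Set.exists_ne_of_one_lt_ncard (by omega : 1 < K.ncard) i
    obtain ⟨k, hk, h1, -⟩ := hlink i hi j hj hne.symm
    exact ⟨k, hk, h1⟩
  have hmem : ∀ i j, Adj g z i j → (x i).1 ∈ V := fun i j h => ⟨_, (hE _ _).2 ⟨i, j, rfl, rfl, h⟩⟩
  let G := graph (separable f) x z ν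
  have hGadj : ∀ i j (h : Adj g z i j),
      G.Adj ⟨(x i).1, hmem i j h⟩ ⟨(x j).1, hmem j i h.symm⟩ := by
    intro i j h
    refine (SimpleGraph.fromRel_adj _ _ _).2 ⟨?_, Or.inl ((hE _ _).2 ⟨i, j, rfl, rfl, h⟩)⟩
    intro h'
    exact h.1 (hx1 (Subtype.mk.inj h'))
  obtain ⟨i0, hi0⟩ : K.Nonempty := by
    rw [← Set.ncard_pos hcore]; omega
  obtain ⟨k0, -, hik0⟩ := hexists i0 hi0
  let v0 : V := ⟨(x i0).1, hmem i0 k0 hik0⟩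
  have hreachK : ∀ i ∈ K, ∀ hi : (x i).1 ∈ V, G.Reachable v0 ⟨(x i).1, hi⟩ := by
    intro i hiK hi
    by_cases h : i0 = i
    · subst h; exact SimpleGraph.Reachable.refl _
    · obtain ⟨k, -, h1, h2⟩ := hlink i0 hi0 i hiK h
      exact (hGadj _ _ h1).reachable.trans (hGadj _ _ h2).symm.reachable
  have hsub : (fun i => (x i).1) '' (K ∪ T) ⊆ Subtype.val '' (G.connectedComponentMk v0).supp := by
    rintro _ ⟨i, hi | ⟨-, k, hk, hik⟩, rfl⟩
    · obtain ⟨k, -, hik⟩ := hexists i hi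
      refine ⟨⟨_, hmem i k hik⟩, ?_, rfl⟩
      exact SimpleGraph.ConnectedComponent.sound (hreachK i hi _).symm
    · refine ⟨⟨_, hmem i k hik⟩, ?_, rfl⟩
      exact SimpleGraph.ConnectedComponent.sound
        ((hGadj _ _ hik).reachable.trans (hreachK k hk _).symm)
  have hle : ((K.ncard + T.ncard : ℕ) : ℕ∞) ≤ largestComponentSize G := by
    have hd : Disjoint K T := Set.disjoint_left.2 fun i hi hi' => hi'.1 hi
    calc ((K.ncard + T.ncard : ℕ) : ℕ∞) = (K ∪ T).encard := by
          rw [Set.encard_union_eq hd, ← hTf.cast_ncard_eq, ← hcore.cast_ncard_eq]; simp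
      _ = ((fun i => (x i).1) '' (K ∪ T)).encard := (hx1.encard_image _).symm
      _ ≤ _ := Set.encard_le_encard hsub
      _ = _ := Subtype.val_injective.encard_image _
      _ ≤ _ := le_iSup (fun C : G.ConnectedComponent => C.supp.encard) _
  have htop : largestComponentSize G ≠ ⊤ := by
    refine ne_top_of_le_ne_top hVf.encard_lt_top.ne (iSup_le fun C => ?_)
    rw [← Subtype.val_injective.encard_image]
    exact Set.encard_le_encard (by rintro _ ⟨a, -, rfl⟩; exact a.2)
  have hle' : ((K.ncard : ℝ) + T.ncard) ≤ ((largestComponentSize G).toNat : ℝ) := by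
    have := ENat.toNat_le_toNat hle htop
    rw [ENat.toNat_natCast] at this
    exact_mod_cast this
  have hVn' : (V.ncard : ℝ) ≤ K.ncard + T.ncard + B.ncard := by exact_mod_cast hVn
  have hK2 : (2 : ℝ) ≤ K.ncard := by exact_mod_cast hcard
  have hT0 : (0 : ℝ) ≤ T.ncard := by positivity
  refine lt_of_lt_of_le ?_ hle'
  -- For `ε ≤ 1` the factor `(1 - ε) * (1 + ε) = 1 - ε ^ 2` gives strictness; for `ε > 1` the left
  -- side is nonpositive.
  rcases le_or_gt ε 1 with h | h
  · have h1 : (1 - ε) * (V.ncard : ℝ) ≤ (1 - ε) * ((1 + ε) * (K.ncard + T.ncard)) :=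
      mul_le_mul_of_nonneg_left (by linarith) (by linarith)
    have h2 : 0 < ε ^ 2 * ((K.ncard : ℝ) + T.ncard) := by positivity
    nlinarith
  · have : (1 - ε) * (V.ncard : ℝ) ≤ 0 :=
      mul_nonpos_of_nonpos_of_nonneg (by linarith) (by positivity)
    linarith

end Graph

/-! ### Cardinalities of random index sets and a second moment bound -/

section RandomSet

variable {Ω : Type*} [MeasurableSpace Ω] {P : Measure Ω}

lemma encard_eq_tsum (S : Set ℕ) : (S.encard : ℝ≥0∞) = ∑' i, S.indicator 1 i := by
  rw [← ENNReal.tsum_set_one, tsum_subtype S (fun _ => (1 : ℝ≥0∞))]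
  rfl

lemma measurable_encard {S : Ω → Set ℕ} (hS : ∀ i, MeasurableSet {ω | i ∈ S ω}) :
    Measurable fun ω => ((S ω).encard : ℝ≥0∞) := by
  simp_rw [encard_eq_tsum]
  refine Measurable.tsum fun i => ?_
  exact (measurable_const (a := (1 : ℝ≥0∞))).indicator (hS i)

lemma lintegral_encard {S : Ω → Set ℕ} (hS : ∀ i, MeasurableSet {ω | i ∈ S ω}) :
    ∫⁻ ω, ((S ω).encard : ℝ≥0∞) ∂P = ∑' i, P {ω | i ∈ S ω} := by
  simp_rw [encard_eq_tsum]
  rw [lintegral_tsum]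
  · refine tsum_congr fun i => ?_
    rw [← lintegral_indicator_one (hS i)]
    rfl
  · intro i
    exact ((measurable_const (a := (1 : ℝ≥0∞))).indicator (hS i)).aemeasurable

/-- Lower tail bound for a sum of pairwise independent indicators. -/
lemma measure_sum_indicator_lt [IsProbabilityMeasure P] {B : ℕ → Set Ω} (F : Finset ℕ)
    (hB : ∀ i ∈ F, MeasurableSet (B i))
    (hind : ∀ i ∈ F, ∀ j ∈ F, i ≠ j → P (B i ∩ B j) = P (B i) * P (B j))
    {n : ℝ} (hn : 0 < n) :
    P {ω | ∑ i ∈ F, (B i).indicator 1 ω + n < (∑ i ∈ F, P.real (B i) + n) / 2} ≤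
      ENNReal.ofReal (4 / n) := by
  set Y : ℕ → Ω → ℝ := fun i => (B i).indicator 1 with hY
  have hmem : ∀ i ∈ F, MemLp (Y i) 2 P := fun i hi =>
    memLp_indicator_const 2 (hB i hi) (1 : ℝ) (Or.inr (measure_ne_top _ _))
  have hint : ∀ i ∈ F, ∫ ω, Y i ω ∂P = P.real (B i) := fun i hi => integral_indicator_one (hB i hi)
  have hvar : ∀ i ∈ F, variance (Y i) P ≤ P.real (B i) := by
    intro i hi
    refine (variance_le_expectation_sq (hmem i hi).aestronglyMeasurable).trans ?_
    rw [← hint i hi]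
    refine le_of_eq (integral_congr_ae (ae_of_all _ fun ω => ?_))
    by_cases h : ω ∈ B i <;> simp [hY, h]
  set M := ∑ i ∈ F, P.real (B i) with hM
  have hM0 : 0 ≤ M := Finset.sum_nonneg fun i _ => measureReal_nonneg
  have hpair : Set.Pairwise (↑F) fun i j => IndepFun (Y i) (Y j) P := by
    intro i hi j hj hij
    have : IndepSet (B i) (B j) P :=
      (indepSet_iff_measure_inter_eq_mul (hB i hi) (hB j hj) P).2 (hind i hi j hj hij)
    exact (IndepFun_iff_Indep _ _ _).2 (indep_of_indep_of_le ((IndepSet_iff_Indep _ _ _).1 this)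
      (MeasurableSpace.comap_indicator_const_le_generateFrom_singleton _ 1)
      (MeasurableSpace.comap_indicator_const_le_generateFrom_singleton _ 1))
  have hV : variance (∑ i ∈ F, Y i) P ≤ M := by
    rw [IndepFun.variance_sum hmem hpair]
    exact Finset.sum_le_sum hvar
  have hE : ∫ ω, (∑ i ∈ F, Y i) ω ∂P = M := by
    simp only [Finset.sum_apply]
    rw [integral_finsetSum _ fun i hi => (hmem i hi).integrable (by norm_num)]
    exact Finset.sum_congr rfl hint
  -- The event is a deviation of more than `(M + n) / 2` below the mean `M`, and the variance is at
  -- most `M`; Chebyshev gives `4 * M / (M + n) ^ 2 ≤ 4 / n`, uniformly in `M`.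
  have hc : 0 < (M + n) / 2 := by positivity
  refine (measure_mono ?_).trans
    ((meas_ge_le_variance_div_sq (memLp_finsetSum' F hmem) hc).trans
      (ENNReal.ofReal_le_ofReal ?_))
  · intro ω hω
    simp only [Set.mem_ofPred_eq] at hω ⊢
    rw [hE, Finset.sum_apply, le_abs]
    right
    linarith
  · calc variance (∑ i ∈ F, Y i) P / ((M + n) / 2) ^ 2 ≤ M / ((M + n) / 2) ^ 2 := by gcongr
      _ ≤ 4 / n := by
        rw [div_le_div_iff₀ (by positivity) hn]
        nlinarith [sq_nonneg M, sq_nonneg n, mul_nonneg hM0 hn.le]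

end RandomSet

/-! ### Independence of events that depend on disjoint sets of edges -/

section Edges

variable {Ω : Type*} {ζ : Sym2 ℕ → Ω → ℝ}

/-- The `σ`-algebra generated by the edge variables with index in `S`. -/
abbrev edgeSigma (ζ : Sym2 ℕ → Ω → ℝ) (S : Set (Sym2 ℕ)) : MeasurableSpace Ω :=
  ⨆ e ∈ S, MeasurableSpace.comap (ζ e) inferInstance

lemma edgeSigma_mono {S T : Set (Sym2 ℕ)} (h : S ⊆ T) : edgeSigma ζ S ≤ edgeSigma ζ T :=
  biSup_mono h

lemma measurableSet_edgeSigma_lt {S : Set (Sym2 ℕ)} {e : Sym2 ℕ} (he : e ∈ S) (w : ℝ) :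
    MeasurableSet[edgeSigma ζ S] {ω | ζ e ω < w} :=
  (le_iSup₂ (f := fun e (_ : e ∈ S) => MeasurableSpace.comap (ζ e) inferInstance) e he) _
    ⟨Set.Iio w, measurableSet_Iio, rfl⟩

lemma measurableSet_edgeSigma_adj {S : Set (Sym2 ℕ)} (g : ℕ → ℝ) {i j : ℕ}
    (h : i ≠ j → s(i, j) ∈ S) :
    MeasurableSet[edgeSigma ζ S] {ω | Adj g (fun e => ζ e ω) i j} := by
  by_cases hij : i = j
  · simp [Adj, hij]
  · simpa [Adj, hij] using measurableSet_edgeSigma_lt (h hij) _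

variable [MeasurableSpace Ω] {P : Measure Ω}

lemma edgeSigma_le (hm : ∀ e, Measurable (ζ e)) (S : Set (Sym2 ℕ)) :
    edgeSigma ζ S ≤ ‹MeasurableSpace Ω› :=
  iSup₂_le fun e _ => (hm e).comap_le

lemma measure_inter_of_disjoint (hm : ∀ e, Measurable (ζ e)) (hi : iIndepFun ζ P)
    {S T : Set (Sym2 ℕ)} (hST : Disjoint S T) {A B : Set Ω}
    (hA : MeasurableSet[edgeSigma ζ S] A) (hB : MeasurableSet[edgeSigma ζ T] B) :
    P (A ∩ B) = P A * P B :=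
  (Indep_iff _ _ _).1 (indep_iSup_of_disjoint (fun e => (hm e).comap_le)
    ((iIndepFun_iff_iIndep _ _ _).1 hi) hST) A B hA hB

lemma measure_biInter_of_disjoint [IsProbabilityMeasure P] (hm : ∀ e, Measurable (ζ e))
    (hi : iIndepFun ζ P) {S : ℕ → Set (Sym2 ℕ)} {A : ℕ → Set Ω} (L : Finset ℕ)
    (hS : ∀ k ∈ L, ∀ l ∈ L, k ≠ l → Disjoint (S k) (S l))
    (hA : ∀ k ∈ L, MeasurableSet[edgeSigma ζ (S k)] (A k)) :
    P (⋂ k ∈ L, A k) = ∏ k ∈ L, P (A k) := by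
  induction L using Finset.induction_on with
  | empty => simp
  | insert a L ha ih =>
    rw [Finset.set_biInter_insert, Finset.prod_insert ha,
      measure_inter_of_disjoint hm hi (S := S a) (T := ⋃ k ∈ L, S k), ih]
    · exact fun k hk l hl => hS k (Finset.mem_insert_of_mem hk) l (Finset.mem_insert_of_mem hl)
    · exact fun k hk => hA k (Finset.mem_insert_of_mem hk)
    · simp only [Set.disjoint_iUnion_right]
      intro k hk
      exact hS a (Finset.mem_insert_self _ _) k (Finset.mem_insert_of_mem hk)
        (fun h => ha (h ▸ hk))
    · exact hA a (Finset.mem_insert_self _ _)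
    · refine @Finset.measurableSet_biInter _ _ (edgeSigma ζ (⋃ k ∈ L, S k)) _ L fun k hk => ?_
      exact edgeSigma_mono (Set.subset_biUnion_of_mem (u := S) (show k ∈ (L : Set ℕ) from hk)) _
        (hA k (Finset.mem_insert_of_mem hk))

lemma measure_edge_lt (hu : ∀ e, HasLaw (ζ e) (volume.restrict (Set.Icc (0 : ℝ) 1)) P)
    (e : Sym2 ℕ) {w : ℝ} (hw : w ≤ 1) : P {ω | ζ e ω < w} = ENNReal.ofReal w := by
  have h := Measure.map_apply_of_aemeasurable (hu e).aemeasurable (measurableSet_Iio (a := w))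
  rw [(hu e).map_eq, Measure.restrict_apply measurableSet_Iio] at h
  change P (ζ e ⁻¹' Set.Iio w) = _
  rw [← h]
  have : Set.Iio w ∩ Set.Icc 0 1 = Set.Ico 0 w := by
    ext t
    simp only [Set.mem_inter_iff, Set.mem_Iio, Set.mem_Icc, Set.mem_Ico]
    constructor
    · rintro ⟨h1, h2, -⟩; exact ⟨h2, h1⟩
    · rintro ⟨h1, h2⟩; exact ⟨h2, h1, h2.le.trans hw⟩
  rw [this]
  simp

end Edges

/-- `ζ` is an i.i.d. family of measurable uniform variables on `[0, 1]`. -/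
structure UniformEdges {Ω : Type*} [MeasurableSpace Ω] (ζ : Sym2 ℕ → Ω → ℝ) (P : Measure Ω) :
    Prop where
  measurable : ∀ e, Measurable (ζ e)
  uniform : ∀ e, HasLaw (ζ e) (volume.restrict (Set.Icc (0 : ℝ) 1)) P
  iIndep : iIndepFun ζ P

/-! ### Edge probabilities and connectivity of the core -/

section Bounds

variable {Ω : Type*} {ζ : Sym2 ℕ → Ω → ℝ} {g : ℕ → ℝ}

lemma measurableSet_edgeSigma_forall_not_adj (ζ : Sym2 ℕ → Ω → ℝ) (i : ℕ) (K : Finset ℕ) :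
    MeasurableSet[edgeSigma ζ ((fun j => s(i, j)) '' K)]
      {ω | ∀ j ∈ K, ¬ Adj g (fun e => ζ e ω) i j} := by
  have : {ω | ∀ j ∈ K, ¬ Adj g (fun e => ζ e ω) i j} =
      ⋂ j ∈ K, {ω | Adj g (fun e => ζ e ω) i j}ᶜ := by
    ext; simp
  rw [this]
  refine @Finset.measurableSet_biInter _ _ (edgeSigma ζ ((fun j => s(i, j)) '' K)) _ K
    fun j hj => @MeasurableSet.compl _ _ (edgeSigma ζ ((fun j => s(i, j)) '' K)) ?_
  exact measurableSet_edgeSigma_adj g fun _ => ⟨j, hj, rfl⟩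

variable [MeasurableSpace Ω] {P : Measure Ω}

lemma measurableSet_adj (hζ : UniformEdges ζ P) (i j : ℕ) :
    MeasurableSet {ω | Adj g (fun e => ζ e ω) i j} :=
  edgeSigma_le hζ.measurable _ _ (measurableSet_edgeSigma_adj (S := Set.univ) g fun _ => trivial)

lemma measure_adj (hζ : UniformEdges ζ P) {i j : ℕ} (hij : i ≠ j) (h1 : g i * g j ≤ 1) :
    P {ω | Adj g (fun e => ζ e ω) i j} = ENNReal.ofReal (g i * g j) := by
  simpa [Adj, hij] using measure_edge_lt hζ.uniform s(i, j) h1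

variable [IsProbabilityMeasure P]

lemma measure_not_adj (hζ : UniformEdges ζ P) {i j : ℕ} (hij : i ≠ j) (h0 : 0 ≤ g i * g j)
    (h1 : g i * g j ≤ 1) :
    P {ω | ¬ Adj g (fun e => ζ e ω) i j} = ENNReal.ofReal (1 - g i * g j) := by
  rw [show {ω | ¬ Adj g (fun e => ζ e ω) i j} = {ω | Adj g (fun e => ζ e ω) i j}ᶜ from rfl,
    measure_compl (measurableSet_adj hζ i j) (measure_ne_top _ _), measure_adj hζ hij h1,
    measure_univ, ENNReal.ofReal_sub _ h0, ENNReal.ofReal_one]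

/-- The edges from `i` to `K` are independent, and `1 - t ≤ exp (-t)` bounds each factor. -/
lemma measure_forall_not_adj_le (hζ : UniformEdges ζ P) (h0 : ∀ i, 0 ≤ g i)
    (h1 : ∀ i j, i ≠ j → g i * g j ≤ 1) (i : ℕ) (K : Finset ℕ) (hiK : i ∉ K) :
    P {ω | ∀ j ∈ K, ¬ Adj g (fun e => ζ e ω) i j} ≤
      ENNReal.ofReal (Real.exp (-(g i * ∑ j ∈ K, g j))) := by
  have hne : ∀ j ∈ K, i ≠ j := fun j hj h => hiK (h ▸ hj)
  have : {ω | ∀ j ∈ K, ¬ Adj g (fun e => ζ e ω) i j} =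
      ⋂ j ∈ K, {ω | ¬ Adj g (fun e => ζ e ω) i j} := by
    ext; simp
  rw [this, measure_biInter_of_disjoint hζ.measurable hζ.iIndep (S := fun j => {s(i, j)}),
    Finset.mul_sum, ← Finset.sum_neg_distrib, Real.exp_sum,
    ENNReal.ofReal_prod_of_nonneg fun j _ => (Real.exp_pos _).le]
  · refine Finset.prod_le_prod' fun j hj => ?_
    rw [measure_not_adj hζ (hne j hj) (mul_nonneg (h0 i) (h0 j)) (h1 i j (hne j hj))]
    exact ENNReal.ofReal_le_ofReal (by linarith [Real.add_one_le_exp (-(g i * g j))])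
  · intro k _ l _ hkl
    rw [Set.disjoint_singleton]
    exact fun h => hkl (Sym2.congr_right.1 h)
  · intro j _
    exact @MeasurableSet.compl _ _ (edgeSigma ζ {s(i, j)})
      (measurableSet_edgeSigma_adj g fun _ => rfl)

/-- The probability that two given core vertices have no common core neighbour is exponentially
small in the size of the core. -/
lemma measure_no_common_neighbour_le (hζ : UniformEdges ζ P)
    (h1 : ∀ i j, i ≠ j → g i * g j ≤ 1) {δ : ℝ} (hδ : 0 < δ) (K : Finset ℕ)
    (hK : ∀ i ∈ K, δ ≤ g i) {i j : ℕ} (hi : i ∈ K) (hj : j ∈ K) (hij : i ≠ j) :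
    P {ω | ∀ k ∈ K, ¬ (Adj g (fun e => ζ e ω) i k ∧ Adj g (fun e => ζ e ω) j k)} ≤
      ENNReal.ofReal (1 - δ ^ 4) ^ (K.card - 2) := by
  set D : ℕ → Set Ω := fun k =>
    {ω | Adj g (fun e => ζ e ω) i k} ∩ {ω | Adj g (fun e => ζ e ω) j k} with hD
  -- Only the other core points can serve as common neighbours, hence the exponent `K.card - 2`.
  -- Different candidates use disjoint pairs of edges.
  set L := (K.erase i).erase j with hL
  have hLi : ∀ k ∈ L, i ≠ k := fun k hk h => by simp [hL, ← h] at hk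
  have hLj : ∀ k ∈ L, j ≠ k := fun k hk h => by simp [hL, ← h] at hk
  have hLK : ∀ k ∈ L, k ∈ K := fun k hk => Finset.mem_of_mem_erase (Finset.mem_of_mem_erase hk)
  have hcard : L.card = K.card - 2 := by
    rw [hL, Finset.card_erase_of_mem (Finset.mem_erase.2 ⟨hij.symm, hj⟩),
      Finset.card_erase_of_mem hi]
    omega
  have hsub : {ω | ∀ k ∈ K, ¬ (Adj g (fun e => ζ e ω) i k ∧ Adj g (fun e => ζ e ω) j k)} ⊆
      ⋂ k ∈ L, (D k)ᶜ := by
    intro ω hω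
    simp only [Set.mem_iInter]
    exact fun k hk hkD => hω k (hLK k hk) hkD
  have hDm : ∀ k, MeasurableSet[edgeSigma ζ {s(i, k), s(j, k)}] (D k) := fun k =>
    @MeasurableSet.inter _ (edgeSigma ζ {s(i, k), s(j, k)}) _ _
      (measurableSet_edgeSigma_adj g fun _ => by simp)
      (measurableSet_edgeSigma_adj g fun _ => by simp)
  refine (measure_mono hsub).trans ?_
  rw [measure_biInter_of_disjoint hζ.measurable hζ.iIndep (S := fun k => {s(i, k), s(j, k)}),
    ← hcard, ← Finset.prod_const]
  · refine Finset.prod_le_prod' fun k hk => ?_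
    have hd : P (D k) = ENNReal.ofReal (g i * g k) * ENNReal.ofReal (g j * g k) := by
      rw [hD, measure_inter_of_disjoint hζ.measurable hζ.iIndep (S := {s(i, k)}) (T := {s(j, k)}),
        measure_adj hζ (hLi k hk) (h1 _ _ (hLi k hk)), measure_adj hζ (hLj k hk)
        (h1 _ _ (hLj k hk))]
      · rw [Set.disjoint_singleton]
        exact fun h => hij (Sym2.congr_left.1 h)
      · exact measurableSet_edgeSigma_adj g fun _ => rfl
      · exact measurableSet_edgeSigma_adj g fun _ => rfl
    rw [measure_compl (edgeSigma_le hζ.measurable _ _ (hDm k)) (measure_ne_top _ _), measure_univ,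
      ENNReal.ofReal_sub _ (by positivity), ENNReal.ofReal_one]
    refine tsub_le_tsub_left ?_ _
    have hgk := hK k (hLK k hk)
    have hgi := hK i hi
    have hgj := hK j hj
    rw [hd, ← ENNReal.ofReal_mul (mul_nonneg (hδ.le.trans hgi) (hδ.le.trans hgk))]
    refine ENNReal.ofReal_le_ofReal ?_
    calc δ ^ 4 = (δ * δ) * (δ * δ) := by ring
      _ ≤ _ := by
        have := hδ.le
        have := hδ.le.trans hgi
        have := hδ.le.trans hgj
        have := hδ.le.trans hgk
        gcongr
  · intro k hk l hl hkl
    rw [Set.disjoint_left]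
    intro e he he'
    simp only [Set.mem_insert_iff, Set.mem_singleton_iff] at he he'
    rcases he with rfl | rfl <;> simp only [Sym2.eq_iff] at he'
    · rcases he' with (h | h) | (h | h)
      · exact hkl h.2
      · exact hLi l hl h.1
      · exact hij h.1
      · exact hLi l hl h.1
    · rcases he' with (h | h) | (h | h)
      · exact hij h.1.symm
      · exact hLj l hl h.1
      · exact hkl h.2
      · exact hLj l hl h.1
  · intro k _
    exact @MeasurableSet.compl _ _ (edgeSigma ζ {s(i, k), s(j, k)}) (hDm k)

lemma measure_not_coreLinked_le (hζ : UniformEdges ζ P)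
    (h1 : ∀ i j, i ≠ j → g i * g j ≤ 1) {δ : ℝ} (hδ : 0 < δ) (K : Finset ℕ)
    (hK : ∀ i, i ∈ K ↔ δ ≤ g i) :
    P {ω | ¬ CoreLinked g δ (fun e => ζ e ω)} ≤
      (K.card : ℝ≥0∞) ^ 2 * ENNReal.ofReal (1 - δ ^ 4) ^ (K.card - 2) := by
  have hsub : {ω | ¬ CoreLinked g δ (fun e => ζ e ω)} ⊆ ⋃ p ∈ K.offDiag,
      {ω | ∀ k ∈ K, ¬ (Adj g (fun e => ζ e ω) p.1 k ∧ Adj g (fun e => ζ e ω) p.2 k)} := by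
    intro ω hω
    simp only [Set.mem_ofPred_eq, CoreLinked, core, not_forall, not_exists, not_and] at hω
    obtain ⟨i, hi, j, hj, hij, h⟩ := hω
    simp only [Set.mem_iUnion]
    refine ⟨(i, j), Finset.mem_offDiag.2 ⟨(hK i).2 hi, (hK j).2 hj, hij⟩, ?_⟩
    exact fun k hk hk' => h k ((hK k).1 hk) hk'.1 hk'.2
  refine (measure_mono hsub).trans ((measure_biUnion_finset_le _ _).trans ?_)
  refine (Finset.sum_le_card_nsmul _ _ (ENNReal.ofReal (1 - δ ^ 4) ^ (K.card - 2))
    fun p hp => ?_).trans ?_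
  · obtain ⟨hi, hj, hij⟩ := Finset.mem_offDiag.1 hp
    exact measure_no_common_neighbour_le hζ h1 hδ K (fun i hi => (hK i).1 hi) hi hj hij
  · rw [nsmul_eq_mul]
    gcongr
    rw [Finset.offDiag_card, sq]
    exact_mod_cast Nat.sub_le _ _

end Bounds

/-! ### Attached and stray points for fixed weights -/

section Attached

/-- The total weight outside the core. -/
noncomputable def outerWeight (g : ℕ → ℝ) (δ : ℝ) : ℝ≥0∞ :=
  ∑' i, (core g δ)ᶜ.indicator (fun i => ENNReal.ofReal (g i)) i

variable {Ω : Type*} {ζ : Sym2 ℕ → Ω → ℝ} {g : ℕ → ℝ} {δ : ℝ} {K : Finset ℕ}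

lemma setOf_mem_attached (hK : ∀ i, i ∈ K ↔ δ ≤ g i) {i : ℕ} (hi : i ∉ K) :
    {ω | i ∈ attached g δ (fun e => ζ e ω)} = {ω | ∀ j ∈ K, ¬ Adj g (fun e => ζ e ω) i j}ᶜ := by
  ext ω
  have hi' : g i < δ := lt_of_not_ge fun h => hi ((hK i).2 h)
  simp [attached, core, hK, hi']

variable [MeasurableSpace Ω] {P : Measure Ω}

lemma measurableSet_attached (hζ : UniformEdges ζ P) (i : ℕ) :
    MeasurableSet {ω | i ∈ attached g δ (fun e => ζ e ω)} := by
  have h : ∀ j, Measurable fun ω => Adj g (fun e => ζ e ω) i j := fun j =>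
    measurableSet_setOfPred.1 (measurableSet_adj hζ i j)
  simp only [attached, Set.mem_ofPred_eq, measurableSet_setOfPred]
  fun_prop

lemma measurableSet_stray (hζ : UniformEdges ζ P) (i : ℕ) :
    MeasurableSet {ω | i ∈ stray g δ (fun e => ζ e ω)} := by
  have h : ∀ j, Measurable fun ω => Adj g (fun e => ζ e ω) i j := fun j =>
    measurableSet_setOfPred.1 (measurableSet_adj hζ i j)
  simp only [stray, Set.mem_ofPred_eq, measurableSet_setOfPred]
  fun_prop

/-- An edge from `i` to the core is never an edge from `j` to the core, because neither `i` nor `j`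
is in the core. Chebyshev's inequality needs this pairwise independence. -/
lemma measure_attached_inter (hζ : UniformEdges ζ P) [IsProbabilityMeasure P]
    (hK : ∀ i, i ∈ K ↔ δ ≤ g i) {i j : ℕ} (hi : i ∉ K) (hj : j ∉ K) (hij : i ≠ j) :
    P ({ω | i ∈ attached g δ (fun e => ζ e ω)} ∩ {ω | j ∈ attached g δ (fun e => ζ e ω)}) =
      P {ω | i ∈ attached g δ (fun e => ζ e ω)} * P {ω | j ∈ attached g δ (fun e => ζ e ω)} := by
  refine measure_inter_of_disjoint hζ.measurable hζ.iIndep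
    (S := (fun k => s(i, k)) '' K) (T := (fun k => s(j, k)) '' K) ?_ ?_ ?_
  · rw [Set.disjoint_left]
    rintro _ ⟨k, hk, rfl⟩ ⟨l, hl, h⟩
    rcases Sym2.eq_iff.1 h with h | h
    · exact hij h.1.symm
    · exact hj (h.1 ▸ hk)
  · rw [setOf_mem_attached hK hi]
    exact @MeasurableSet.compl _ _ (edgeSigma ζ _) (measurableSet_edgeSigma_forall_not_adj ζ i K)
  · rw [setOf_mem_attached hK hj]
    exact @MeasurableSet.compl _ _ (edgeSigma ζ _) (measurableSet_edgeSigma_forall_not_adj ζ j K)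

lemma one_sub_exp_le_measure_attached (hζ : UniformEdges ζ P) [IsProbabilityMeasure P]
    (h0 : ∀ i, 0 ≤ g i) (h1 : ∀ i j, i ≠ j → g i * g j ≤ 1) (hK : ∀ i, i ∈ K ↔ δ ≤ g i)
    {i : ℕ} (hi : i ∉ K) :
    ENNReal.ofReal (1 - Real.exp (-(g i * ∑ j ∈ K, g j))) ≤
      P {ω | i ∈ attached g δ (fun e => ζ e ω)} := by
  rw [setOf_mem_attached hK hi, measure_compl _ (measure_ne_top _ _), measure_univ,
    ENNReal.ofReal_sub _ (Real.exp_pos _).le, ENNReal.ofReal_one]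
  · exact tsub_le_tsub_left (measure_forall_not_adj_le hζ h0 h1 i K hi) _
  · exact edgeSigma_le hζ.measurable _ _ (measurableSet_edgeSigma_forall_not_adj ζ i K)

lemma measure_attached_le (hζ : UniformEdges ζ P) [IsProbabilityMeasure P]
    (h0 : ∀ i, 0 ≤ g i) (h1 : ∀ i j, i ≠ j → g i * g j ≤ 1) (hK : ∀ i, i ∈ K ↔ δ ≤ g i) (i : ℕ) :
    P {ω | i ∈ attached g δ (fun e => ζ e ω)} ≤
      (core g δ)ᶜ.indicator (fun i => ENNReal.ofReal (g i)) i * ENNReal.ofReal (∑ j ∈ K, g j) := by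
  by_cases hi : i ∈ core g δ
  · simp [attached, hi]
  rw [Set.indicator_of_mem (by exact hi)]
  have hiK : i ∉ K := fun h => hi ((hK i).1 h)
  have hsub : {ω | i ∈ attached g δ (fun e => ζ e ω)} ⊆
      ⋃ j ∈ K, {ω | Adj g (fun e => ζ e ω) i j} := by
    rintro ω ⟨-, j, hj, hij⟩
    simp only [Set.mem_iUnion]
    exact ⟨j, (hK j).2 hj, hij⟩
  refine (measure_mono hsub).trans ((measure_biUnion_finset_le _ _).trans ?_)
  rw [ENNReal.ofReal_sum_of_nonneg fun j _ => h0 j, Finset.mul_sum]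
  refine Finset.sum_le_sum fun j hj => ?_
  have hij : i ≠ j := fun h => hiK (h ▸ hj)
  rw [measure_adj hζ hij (h1 i j hij), ENNReal.ofReal_mul (h0 i)]

/-- A stray point has no edge into the core but an edge to some `l` outside it. These two events
involve disjoint edges; sum over `l`. -/
lemma measure_stray_le (hζ : UniformEdges ζ P) [IsProbabilityMeasure P]
    (h0 : ∀ i, 0 ≤ g i) (h1 : ∀ i j, i ≠ j → g i * g j ≤ 1) (hK : ∀ i, i ∈ K ↔ δ ≤ g i)
    {i : ℕ} (hi : i ∉ K) :
    P {ω | i ∈ stray g δ (fun e => ζ e ω)} ≤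
      ENNReal.ofReal (Real.exp (-(g i * ∑ j ∈ K, g j)) * g i) * outerWeight g δ := by
  set A := {ω | ∀ j ∈ K, ¬ Adj g (fun e => ζ e ω) i j} with hA
  have hsub : {ω | i ∈ stray g δ (fun e => ζ e ω)} ⊆
      ⋃ l, (if l ∈ K then ∅ else A ∩ {ω | Adj g (fun e => ζ e ω) i l}) := by
    rintro ω ⟨-, h, l, hl⟩
    refine Set.mem_iUnion.2 ⟨l, ?_⟩
    have hlK : l ∉ K := fun hlK => h l ((hK l).1 hlK) hl
    rw [if_neg hlK]
    exact ⟨fun j hj => h j ((hK j).1 hj), hl⟩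
  refine (measure_mono hsub).trans ((measure_iUnion_le _).trans ?_)
  rw [outerWeight, ← ENNReal.tsum_mul_left]
  refine ENNReal.tsum_le_tsum fun l => ?_
  by_cases hl : l ∈ K
  · simp [hl]
  rw [if_neg hl, Set.indicator_of_mem (by exact fun h => hl ((hK l).2 h))]
  by_cases hil : i = l
  · subst hil
    simp [Adj]
  rw [measure_inter_of_disjoint hζ.measurable hζ.iIndep (S := (fun k => s(i, k)) '' K)
      (T := {s(i, l)}), measure_adj hζ hil (h1 i l hil), ENNReal.ofReal_mul (h0 i),
      ENNReal.ofReal_mul (Real.exp_pos _).le, mul_assoc]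
  · gcongr
    exact measure_forall_not_adj_le hζ h0 h1 i K hi
  · rw [Set.disjoint_singleton_right]
    rintro ⟨k, hk, h⟩
    exact hl (Sym2.congr_right.1 h ▸ hk)
  · exact measurableSet_edgeSigma_forall_not_adj ζ i K
  · exact measurableSet_edgeSigma_adj g fun _ => rfl

/-- Multiply `t + 1 ≤ exp t` by `exp (-t)`. This compares the stray and attached probabilities at `t
= g i * S`. -/
lemma mul_exp_neg_le_one_sub_exp_neg (t : ℝ) : t * Real.exp (-t) ≤ 1 - Real.exp (-t) := by
  have h := Real.add_one_le_exp t
  have h2 : Real.exp t * Real.exp (-t) = 1 := by rw [← Real.exp_add]; simp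
  nlinarith [Real.exp_pos (-t)]

/-- If most of the weight is in the core and the core is large, then the graph is typical with high
probability. -/
theorem measure_not_typical_le (hζ : UniformEdges ζ P) [IsProbabilityMeasure P]
    (h0 : ∀ i, 0 ≤ g i) (h1 : ∀ i j, i ≠ j → g i * g j ≤ 1) (hδ : 0 < δ)
    (hK : ∀ i, i ∈ K ↔ δ ≤ g i) (hn : K.Nonempty) {η ε : ℝ} (hη : 0 ≤ η) (hε : 0 < ε)
    (hO : outerWeight g δ ≤ ENNReal.ofReal (η * ∑ j ∈ K, g j)) :
    P {ω | ¬ Typical g δ ε (fun e => ζ e ω)} ≤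
      (K.card : ℝ≥0∞) ^ 2 * ENNReal.ofReal (1 - δ ^ 4) ^ (K.card - 2) +
        ENNReal.ofReal (4 / K.card) + ENNReal.ofReal (4 * η / ε) := by
  set S := ∑ j ∈ K, g j with hS
  have hS0 : 0 ≤ S := Finset.sum_nonneg fun j _ => h0 j
  -- `m i` is the lower bound for the probability of being attached; its sum `M` is the common
  -- yardstick for attached and stray points.
  set m : ℕ → ℝ := fun i => if i ∈ K then 0 else 1 - Real.exp (-(g i * S)) with hm
  have hm0 : ∀ i, 0 ≤ m i := by
    intro i
    simp only [hm]
    split_ifs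
    · rfl
    · have : Real.exp (-(g i * S)) ≤ 1 := Real.exp_le_one_iff.2 (by
        have := mul_nonneg (h0 i) hS0; linarith)
      linarith
  set n : ℝ := (K.card : ℝ) with hnd
  have hn0 : 0 < n := by simpa [hnd] using hn.card_pos
  have hOtop : outerWeight g δ < ⊤ := hO.trans_lt ENNReal.ofReal_lt_top
  have hatt : ∫⁻ ω, ((attached g δ (fun e => ζ e ω)).encard : ℝ≥0∞) ∂P < ⊤ := by
    rw [lintegral_encard fun i => measurableSet_attached hζ i]
    refine (ENNReal.tsum_le_tsum fun i => measure_attached_le hζ h0 h1 hK i).trans_lt ?_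
    rw [ENNReal.tsum_mul_right]
    exact ENNReal.mul_lt_top hOtop ENNReal.ofReal_lt_top
  have hatt0 : P {ω | ¬ ((attached g δ (fun e => ζ e ω)).encard : ℝ≥0∞) < ⊤} = 0 :=
    ae_lt_top (measurable_encard fun i => measurableSet_attached hζ i) hatt.ne
  have hpm : ∀ i, i ∉ K → ENNReal.ofReal (m i) ≤ P {ω | i ∈ attached g δ (fun e => ζ e ω)} := by
    intro i hi
    simp only [hm, hi, if_false]
    exact one_sub_exp_le_measure_attached hζ h0 h1 hK hi
  have hMtop : ∑' i, ENNReal.ofReal (m i) ≠ ⊤ := by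
    refine ne_top_of_le_ne_top hatt.ne ?_
    rw [lintegral_encard fun i => measurableSet_attached hζ i]
    refine ENNReal.tsum_le_tsum fun i => ?_
    by_cases hi : i ∈ K
    · simp [hm, hi]
    · exact hpm i hi
  have hsum : Summable m := by
    have := ENNReal.summable_toReal hMtop
    simpa [ENNReal.toReal_ofReal (hm0 _)] using this
  set M := ∑' i, m i with hM
  have hM0 : 0 ≤ M := tsum_nonneg hm0
  have hMe : ∑' i, ENNReal.ofReal (m i) = ENNReal.ofReal M :=
    (ENNReal.ofReal_tsum_of_nonneg hm0 hsum).symm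
  -- The second moment bound needs a finite sum; a loss of `n`, the size of the core, is affordable.
  obtain ⟨F, hF⟩ : ∃ F : Finset ℕ, M - n < ∑ i ∈ F, m i :=
    (hsum.hasSum.eventually_const_lt (by linarith)).exists
  set F' := F.filter (· ∉ K) with hF'
  have hFF' : ∑ i ∈ F, m i = ∑ i ∈ F', m i := by
    rw [hF', Finset.sum_filter]
    refine Finset.sum_congr rfl fun i _ => ?_
    by_cases hi : i ∈ K <;> simp [hm, hi]
  have hF'K : ∀ i ∈ F', i ∉ K := fun i hi => (Finset.mem_filter.1 hi).2
  -- the mean number of stray indices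
  have hstray : ∫⁻ ω, ((stray g δ (fun e => ζ e ω)).encard : ℝ≥0∞) ∂P ≤ ENNReal.ofReal (η * M) := by
    rw [lintegral_encard fun i => measurableSet_stray hζ i, ENNReal.ofReal_mul hη, ← hMe,
      ← ENNReal.tsum_mul_left]
    refine ENNReal.tsum_le_tsum fun i => ?_
    by_cases hi : i ∈ K
    · have hi' : i ∈ core g δ := (hK i).1 hi
      simp [stray, hi']
    refine (measure_stray_le hζ h0 h1 hK hi).trans ((mul_le_mul_right hO _).trans ?_)
    rw [← ENNReal.ofReal_mul (mul_nonneg (Real.exp_pos _).le (h0 i)), ← ENNReal.ofReal_mul hη]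
    refine ENNReal.ofReal_le_ofReal ?_
    simp only [hm, hi, if_false]
    have := mul_le_mul_of_nonneg_left (mul_exp_neg_le_one_sub_exp_neg (g i * S)) hη
    linarith
  have hmarkov : P {ω | ENNReal.ofReal (ε / 4 * (M + n)) ≤
      ((stray g δ (fun e => ζ e ω)).encard : ℝ≥0∞)} ≤ ENNReal.ofReal (4 * η / ε) := by
    have hpos : 0 < ε / 4 * (M + n) := by positivity
    refine (meas_ge_le_lintegral_div (measurable_encard fun i =>
      measurableSet_stray hζ i).aemeasurable (by simpa using hpos) ENNReal.ofReal_ne_top).trans ?_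
    refine (ENNReal.div_le_div_right hstray _).trans ?_
    rw [← ENNReal.ofReal_div_of_pos hpos]
    refine ENNReal.ofReal_le_ofReal ?_
    rw [div_le_div_iff₀ hpos hε]
    have : 0 ≤ η * ε * n := by positivity
    nlinarith
  have hcheb := measure_sum_indicator_lt (P := P)
    (B := fun i => {ω | i ∈ attached g δ (fun e => ζ e ω)}) F'
    (fun i _ => measurableSet_attached hζ i)
    (fun i hi j hj hij => measure_attached_inter hζ hK (hF'K i hi) (hF'K j hj) hij) hn0
  have hreal : ∑ i ∈ F', m i ≤ ∑ i ∈ F', P.real {ω | i ∈ attached g δ (fun e => ζ e ω)} := by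
    refine Finset.sum_le_sum fun i hi => ?_
    exact (ENNReal.ofReal_le_iff_le_toReal (measure_ne_top _ _)).1 (hpm i (hF'K i hi))
  have hlink := measure_not_coreLinked_le hζ h1 hδ K hK
  have hcard : ((core g δ).encard : ℝ≥0∞) = ENNReal.ofReal n := by
    have : core g δ = (K : Set ℕ) := by ext i; simp [core, hK]
    rw [this, Set.encard_coe_eq_coe_finsetCard, hnd]
    simp
  have hcover : {ω | ¬ Typical g δ ε (fun e => ζ e ω)} ⊆
      ({ω | ¬ CoreLinked g δ (fun e => ζ e ω)} ∪
      {ω | ∑ i ∈ F', {ω | i ∈ attached g δ (fun e => ζ e ω)}.indicator (1 : Ω → ℝ) ω + n <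
        (∑ i ∈ F', P.real {ω | i ∈ attached g δ (fun e => ζ e ω)} + n) / 2} ∪
      {ω | ENNReal.ofReal (ε / 4 * (M + n)) ≤
        ((stray g δ (fun e => ζ e ω)).encard : ℝ≥0∞)}) ∪
      {ω | ¬ ((attached g δ (fun e => ζ e ω)).encard : ℝ≥0∞) < ⊤} := by
    intro ω hω
    by_contra hcon
    simp only [Set.mem_union, Set.mem_ofPred_eq, not_or, not_not, not_lt, not_le] at hcon
    obtain ⟨⟨⟨c1, c2⟩, c3⟩, c4⟩ := hcon
    refine hω ⟨c1, c4, c3.le.trans ?_⟩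
    set T := attached g δ (fun e => ζ e ω) with hT
    have hsumT : ENNReal.ofReal (∑ i ∈ F',
        {ω | i ∈ attached g δ (fun e => ζ e ω)}.indicator (1 : Ω → ℝ) ω) ≤ (T.encard : ℝ≥0∞) := by
      rw [encard_eq_tsum, ENNReal.ofReal_sum_of_nonneg fun i _ => by
        exact Set.indicator_nonneg (fun _ _ => zero_le_one) _]
      refine le_trans (Finset.sum_le_sum fun i _ => ?_) (ENNReal.sum_le_tsum F')
      by_cases h : i ∈ T
      · simp [hT ▸ h, h]
      · simp [hT ▸ h]
    rw [ENNReal.ofReal_mul (by positivity), hcard]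
    calc ENNReal.ofReal (ε / 4) * ENNReal.ofReal (M + n)
        ≤ ENNReal.ofReal (ε / 4) * ENNReal.ofReal (4 * (n + ∑ i ∈ F',
          {ω | i ∈ attached g δ (fun e => ζ e ω)}.indicator (1 : Ω → ℝ) ω)) := by
          gcongr
          -- By `c2`, twice `n` plus the number of attached points in `F'` is at least both `M` and
          -- `n`, hence the factor `4`.
          have := Finset.sum_nonneg (s := F') fun i _ => hm0 i
          linarith
      _ = ENNReal.ofReal ε * ENNReal.ofReal (n + ∑ i ∈ F',
          {ω | i ∈ attached g δ (fun e => ζ e ω)}.indicator (1 : Ω → ℝ) ω) := by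
          rw [← ENNReal.ofReal_mul (by positivity), ← ENNReal.ofReal_mul hε.le]
          congr 1; ring
      _ ≤ ENNReal.ofReal ε * (ENNReal.ofReal n + T.encard) := by
          gcongr
          exact ENNReal.ofReal_add_le.trans (by gcongr)
  refine (measure_mono hcover).trans ((measure_union_le _ _).trans ?_)
  rw [hatt0, add_zero]
  refine (measure_union_le _ _).trans (add_le_add ((measure_union_le _ _).trans
    (add_le_add hlink hcheb)) hmarkov)

end Attached

/-! ### Lebesgue measure on the half-line -/

section Lebesgue

lemma leb_apply (A : Set ℝ≥0) : leb A = volume (((↑) : ℝ≥0 → ℝ) '' A) :=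
  (MeasurableEmbedding.subtype_coe measurableSet_Ici).comap_apply _ _

lemma leb_Ico (a b : ℝ≥0) : leb (Set.Ico a b) = ((b - a : ℝ≥0) : ℝ≥0∞) := by
  have : ((↑) : ℝ≥0 → ℝ) '' Set.Ico a b = Set.Ico (a : ℝ) b := by
    ext t
    constructor
    · rintro ⟨s, ⟨h1, h2⟩, rfl⟩
      exact ⟨by exact_mod_cast h1, by exact_mod_cast h2⟩
    · rintro ⟨h1, h2⟩
      exact ⟨⟨t, a.2.trans h1⟩, ⟨h1, h2⟩, rfl⟩
  rw [leb_apply, this, Real.volume_Ico, NNReal.sub_def]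
  rfl

lemma leb_Iic (a : ℝ≥0) : leb (Set.Iic a) = a := by
  have : ((↑) : ℝ≥0 → ℝ) '' Set.Iic a = Set.Icc (0 : ℝ) a := by
    ext t
    constructor
    · rintro ⟨s, h2, rfl⟩
      exact ⟨s.2, by exact_mod_cast h2⟩
    · rintro ⟨h1, h2⟩
      exact ⟨⟨t, h1⟩, h2, rfl⟩
  rw [leb_apply, this, Real.volume_Icc]
  simp

instance : NullSingletonClass leb := ⟨fun a => by rw [leb_apply]; simp⟩

end Lebesgue

/-! ### Poisson moments, tails and Campbell's formula -/

section Poisson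

/-- Both factorial moments below follow from this identity by a shift of the index. -/
lemma poissonMeasure_succ (r : ℝ≥0) (k : ℕ) :
    ((k + 1 : ℕ) : ℝ≥0∞) * poissonMeasure r {k + 1} = r * poissonMeasure r {k} := by
  rw [poissonMeasure_singleton, poissonMeasure_singleton, ← ENNReal.ofReal_natCast,
    ← ENNReal.ofReal_coe_nnreal, ← ENNReal.ofReal_mul (by positivity),
    ← ENNReal.ofReal_mul (by positivity)]
  congr 1
  rw [Nat.factorial_succ]
  push_cast
  field_simp
  ring

lemma tsum_poissonMeasure (r : ℝ≥0) : ∑' k : ℕ, poissonMeasure r {k} = 1 := by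
  have h := lintegral_countable' (μ := poissonMeasure r) (fun _ => 1)
  simpa using h.symm

lemma tsum_mul_poissonMeasure (r : ℝ≥0) :
    ∑' k : ℕ, (k : ℝ≥0∞) * poissonMeasure r {k} = r := by
  rw [tsum_eq_zero_add' ENNReal.summable]
  simp_rw [poissonMeasure_succ, ENNReal.tsum_mul_left, tsum_poissonMeasure]
  simp

lemma tsum_mul_pred_mul_poissonMeasure (r : ℝ≥0) :
    ∑' k : ℕ, ((k - 1 : ℕ) : ℝ≥0∞) * (k * poissonMeasure r {k}) = r ^ 2 := by
  rw [tsum_eq_zero_add' ENNReal.summable]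
  simp_rw [poissonMeasure_succ, Nat.add_sub_cancel, mul_left_comm _ (r : ℝ≥0∞),
    ENNReal.tsum_mul_left, tsum_mul_poissonMeasure]
  simp [sq]

/-- The ratio of the two masses is `exp (-r / 2) * 2 ^ k`, and `log 2 ≤ 3 / 4` gives `2 ^ k ≤ exp (3
* r / 8)`. Summing over `k` yields the lower tail bound. -/
lemma poissonMeasure_singleton_le (r : ℝ≥0) {k : ℕ} (hk : (k : ℝ) ≤ r / 2) :
    poissonMeasure r {k} ≤ ENNReal.ofReal (Real.exp (-(r / 8))) * poissonMeasure (r / 2) {k} := by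
  rw [poissonMeasure_singleton, poissonMeasure_singleton,
    ← ENNReal.ofReal_mul (Real.exp_pos _).le]
  refine ENNReal.ofReal_le_ofReal ?_
  have h2 : (2 : ℝ) ^ k ≤ Real.exp (3 * r / 8) := by
    rw [← Real.exp_log (x := (2 : ℝ) ^ k) (by positivity), Real.log_pow]
    refine Real.exp_le_exp.2 ?_
    have h1 := Real.log_two_lt_d9
    have hr : (0 : ℝ) ≤ r := r.2
    nlinarith [mul_le_mul_of_nonneg_right hk (Real.log_nonneg (by norm_num : (1 : ℝ) ≤ 2))]
  have hr : (r : ℝ) ^ k = 2 ^ k * (r / 2) ^ k := by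
    rw [← mul_pow]; congr 1; ring
  push_cast
  rw [mul_div_assoc, mul_div_assoc, ← mul_assoc, ← Real.exp_add, hr, mul_div_assoc, ← mul_assoc]
  gcongr
  calc Real.exp (-r) * 2 ^ k ≤ Real.exp (-r) * Real.exp (3 * r / 8) := by gcongr
    _ = Real.exp (-(r / 8) + -(r / 2)) := by rw [← Real.exp_add]; congr 1; ring

variable {Ω E : Type*} [MeasurableSpace Ω] [MeasurableSpace E] {X : ℕ → Ω → E} {m : Measure E}
  {P : Measure Ω}

lemma IsPoissonProcess.lintegral_count_comp (hX : IsPoissonProcess X m P) {A : Set E}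
    (hA : MeasurableSet A) (hAm : m A < ⊤) (φ : ℕ∞ → ℝ≥0∞) :
    ∫⁻ ω, φ (count (fun i => X i ω) A) ∂P =
      ∑' k : ℕ, φ k * poissonMeasure (m A).toNNReal {k} := by
  have h := hX.hasLaw A hA hAm
  have hφ : Measurable φ := measurable_of_countable φ
  rw [← lintegral_map' hφ.aemeasurable h.aemeasurable, h.map_eq,
    lintegral_map hφ (by fun_prop), lintegral_countable']

lemma IsPoissonProcess.lintegral_count (hX : IsPoissonProcess X m P) {A : Set E}
    (hA : MeasurableSet A) (hAm : m A < ⊤) :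
    ∫⁻ ω, (count (fun i => X i ω) A : ℝ≥0∞) ∂P = m A := by
  rw [hX.lintegral_count_comp hA hAm (fun k => (k : ℝ≥0∞))]
  simp only [ENat.toENNReal_coe]
  rw [tsum_mul_poissonMeasure, ENNReal.coe_toNNReal hAm.ne]

/-- Campbell's formula. -/
theorem IsPoissonProcess.lintegral_tsum [SigmaFinite m] (hX : IsPoissonProcess X m P)
    {φ : E → ℝ≥0∞} (hφ : Measurable φ) :
    ∫⁻ ω, ∑' i, φ (X i ω) ∂P = ∫⁻ x, φ x ∂m := by
  -- The sum of the laws of the points is the intensity: on sets of finite measure by the Poisson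
  -- mean, in general by exhaustion.
  have hfin : ∀ A, MeasurableSet A → m A < ⊤ →
      Measure.sum (fun i => P.map (X i)) A = m A := by
    intro A hA hAm
    rw [Measure.sum_apply _ hA, ← hX.lintegral_count hA hAm]
    have := lintegral_encard (P := P) (S := fun ω => {i | X i ω ∈ A})
      fun i => hX.measurable i hA
    refine Eq.trans (tsum_congr fun i => ?_) this.symm
    exact Measure.map_apply (hX.measurable i) hA
  have hsum : Measure.sum (fun i => P.map (X i)) = m := by
    refine Measure.ext fun A hA => ?_
    have hU : A = ⋃ n, A ∩ spanningSets m n := by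
      rw [← Set.inter_iUnion, iUnion_spanningSets, Set.inter_univ]
    have hmono : Monotone fun n => A ∩ spanningSets m n := fun a b h =>
      Set.inter_subset_inter_right _ (monotone_spanningSets m h)
    rw [hU, hmono.measure_iUnion, hmono.measure_iUnion]
    refine iSup_congr fun n => hfin _ (hA.inter (measurableSet_spanningSets m n)) ?_
    exact (measure_mono Set.inter_subset_right).trans_lt (measure_spanningSets_lt_top m n)
  rw [MeasureTheory.lintegral_tsum (f := fun i ω => φ (X i ω)) fun i => (hφ.comp (hX.measurable i)).aemeasurable, ← hsum,
    lintegral_sum_measure]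
  exact tsum_congr fun i => (lintegral_map hφ (hX.measurable i)).symm

lemma IsPoissonProcess.measure_count_mem (hX : IsPoissonProcess X m P) {A : Set E}
    (hA : MeasurableSet A) (hAm : m A < ⊤) (s : Set ℕ∞) :
    P {ω | count (fun i => X i ω) A ∈ s} =
      ∑' k : ℕ, s.indicator 1 (k : ℕ∞) * poissonMeasure (m A).toNNReal {k} := by
  rw [← hX.lintegral_count_comp hA hAm (s.indicator 1)]
  have hs : NullMeasurableSet {ω | count (fun i => X i ω) A ∈ s} P :=
    (hX.hasLaw A hA hAm).aemeasurable.nullMeasurableSet_preimage (Set.to_countable s).measurableSet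
  rw [← lintegral_indicator_one₀ hs]
  rfl

/-- The indicator of `2 ≤ k` is at most `k * (k - 1)`, whose mean is the square of the intensity. -/
lemma IsPoissonProcess.measure_two_le_count_le (hX : IsPoissonProcess X m P) {A : Set E}
    (hA : MeasurableSet A) (hAm : m A < ⊤) :
    P {ω | 2 ≤ count (fun i => X i ω) A} ≤ m A ^ 2 := by
  refine (hX.measure_count_mem hA hAm (Set.Ici 2)).trans_le ?_
  conv_rhs => rw [← ENNReal.coe_toNNReal hAm.ne, ← tsum_mul_pred_mul_poissonMeasure]
  refine ENNReal.tsum_le_tsum fun k => ?_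
  by_cases hk : 2 ≤ k
  · rw [Set.indicator_of_mem (Set.mem_Ici.2 (by exact_mod_cast hk : (2 : ℕ∞) ≤ k)), ← mul_assoc,
      Pi.one_apply, ← Nat.cast_mul]
    gcongr
    exact_mod_cast Nat.mul_pos (by omega) (by omega)
  · rw [Set.indicator_of_notMem]
    · simp
    · simpa using (by exact_mod_cast not_le.1 hk : (k : ℕ∞) < 2)

lemma IsPoissonProcess.measure_count_lt_le (hX : IsPoissonProcess X m P) {A : Set E}
    (hA : MeasurableSet A) (hAm : m A < ⊤) :
    P {ω | (count (fun i => X i ω) A : ℝ≥0∞) < m A / 2} ≤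
      ENNReal.ofReal (Real.exp (-((m A).toReal / 8))) := by
  refine (hX.measure_count_mem hA hAm {k | (k : ℝ≥0∞) < m A / 2}).trans_le ?_
  set r := (m A).toNNReal with hr
  have hmr : m A = r := (ENNReal.coe_toNNReal hAm.ne).symm
  calc _ ≤ ∑' k : ℕ, ENNReal.ofReal (Real.exp (-(r / 8))) * poissonMeasure (r / 2) {k} := by
        refine ENNReal.tsum_le_tsum fun k => ?_
        by_cases hk : (k : ℝ≥0∞) < m A / 2
        · rw [Set.indicator_of_mem (by simpa using hk), Pi.one_apply, one_mul]
          refine poissonMeasure_singleton_le r ?_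
          rw [hmr] at hk
          have := ENNReal.toReal_mono (by finiteness) hk.le
          simpa using this
        · rw [Set.indicator_of_notMem (by simpa using hk)]
          simp
    _ = _ := by
        rw [ENNReal.tsum_mul_left, tsum_poissonMeasure, mul_one]
        rfl

end Poisson

/-! ### Almost surely distinct coordinates -/

section Distinct

variable {Ω : Type*} [MeasurableSpace Ω] {X : ℕ → Ω → ℝ≥0 × ℝ≥0} {P : Measure Ω}

/-- Cut the box of side `n` into `n * M` strips of measure at most `n / M`. A coincidence puts two
points into one strip, which has probability at most `n * M * (n / M) ^ 2`, and this vanishes as `M`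
grows. -/
lemma ae_injective_of_strip (hX : IsPoissonProcess X leb2 P) {g : ℝ≥0 × ℝ≥0 → ℝ≥0}
    (hg : Measurable g) (hgle : ∀ p, g p ≤ max p.1 p.2)
    (hstrip : ∀ (n : ℕ) (a b : ℝ≥0),
      leb2 {p | (p.1 < n ∧ p.2 < n) ∧ g p ∈ Set.Ico a b} ≤ n * ((b - a : ℝ≥0) : ℝ≥0∞)) :
    ∀ᵐ ω ∂P, Function.Injective fun i => g (X i ω) := by
  set D : ℕ → Set Ω := fun n => {ω | ∃ i j, i ≠ j ∧ g (X i ω) = g (X j ω) ∧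
    ((X i ω).1 < n ∧ (X i ω).2 < n) ∧ ((X j ω).1 < n ∧ (X j ω).2 < n)} with hD
  have hsub : {ω | ¬ Function.Injective fun i => g (X i ω)} ⊆ ⋃ n, D n := by
    intro ω hω
    simp only [Set.mem_ofPred_eq, Function.Injective, not_forall] at hω
    obtain ⟨i, j, h, hij⟩ := hω
    obtain ⟨n, hn⟩ := exists_nat_gt (max (max (X i ω).1 (X i ω).2) (max (X j ω).1 (X j ω).2))
    simp only [max_lt_iff] at hn
    exact Set.mem_iUnion.2 ⟨n, i, j, hij, h, hn.1, hn.2⟩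
  refine measure_mono_null hsub (measure_iUnion_null fun n => ?_)
  have hbound : ∀ M : ℕ, 0 < M → P (D n) ≤ (n : ℝ≥0∞) ^ 3 / M := by
    intro M hM
    set A : ℕ → Set (ℝ≥0 × ℝ≥0) := fun k => {p | (p.1 < n ∧ p.2 < n) ∧
      g p ∈ Set.Ico ((k : ℝ≥0) / M) ((k + 1 : ℝ≥0) / M)} with hA
    have hAmeas : ∀ k, MeasurableSet (A k) := fun k =>
      ((measurableSet_lt measurable_fst measurable_const).inter
        (measurableSet_lt measurable_snd measurable_const)).inter (hg measurableSet_Ico)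
    have hAle : ∀ k, leb2 (A k) ≤ (n : ℝ≥0∞) / M := by
      intro k
      refine (hstrip n _ _).trans (le_of_eq ?_)
      rw [← NNReal.sub_div, add_tsub_cancel_left, ENNReal.coe_div (by positivity), mul_div_assoc']
      simp
    have hfin : (n : ℝ≥0∞) / M < ⊤ :=
      ENNReal.div_lt_top (ENNReal.natCast_ne_top n) (by exact_mod_cast hM.ne')
    have hcov : D n ⊆ ⋃ k ∈ Finset.range (n * M), {ω | 2 ≤ count (fun i => X i ω) (A k)} := by
      rintro ω ⟨i, j, hij, h, hi, hj⟩
      have hM' : (0 : ℝ≥0) < M := by exact_mod_cast hM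
      have hmem : g (X i ω) ∈ Set.Ico ((⌊g (X i ω) * M⌋₊ : ℝ≥0) / M)
          ((⌊g (X i ω) * M⌋₊ + 1 : ℝ≥0) / M) := by
        constructor
        · rw [div_le_iff₀ hM']
          exact Nat.floor_le zero_le
        · rw [lt_div_iff₀ hM']
          exact Nat.lt_floor_add_one _
      simp only [Set.mem_iUnion, Finset.mem_range]
      refine ⟨⌊g (X i ω) * M⌋₊, ?_, ?_⟩
      · rw [Nat.floor_lt zero_le, Nat.cast_mul]
        exact mul_lt_mul_of_pos_right ((hgle _).trans_lt (max_lt hi.1 hi.2)) hM'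
      · have : 1 < count (fun l => X l ω) (A ⌊g (X i ω) * M⌋₊) :=
          Set.one_lt_encard_iff.2 ⟨i, j, ⟨hi, hmem⟩, ⟨hj, h ▸ hmem⟩, hij⟩
        exact Order.add_one_le_of_lt this
    calc P (D n) ≤ ∑ k ∈ Finset.range (n * M), P {ω | 2 ≤ count (fun i => X i ω) (A k)} :=
          (measure_mono hcov).trans (measure_biUnion_finset_le _ _)
      _ ≤ ∑ k ∈ Finset.range (n * M), ((n : ℝ≥0∞) / M) ^ 2 := by
          refine Finset.sum_le_sum fun k _ => ?_
          refine (hX.measure_two_le_count_le (hAmeas k) ((hAle k).trans_lt hfin)).trans ?_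
          gcongr
          exact hAle k
      _ = (n : ℝ≥0∞) ^ 3 / M := by
          rw [Finset.sum_const, Finset.card_range, nsmul_eq_mul, Nat.cast_mul]
          have h0 : (M : ℝ≥0∞) ≠ 0 := by exact_mod_cast hM.ne'
          have ht := ENNReal.natCast_ne_top M
          rw [div_eq_mul_inv, div_eq_mul_inv, mul_pow]
          calc (n : ℝ≥0∞) * M * (n ^ 2 * (M : ℝ≥0∞)⁻¹ ^ 2)
              = n ^ 3 * (M : ℝ≥0∞)⁻¹ * (M * (M : ℝ≥0∞)⁻¹) := by ring
            _ = _ := by rw [ENNReal.mul_inv_cancel h0 ht, mul_one]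
  have hlim : Tendsto (fun M : ℕ => (n : ℝ≥0∞) ^ 3 / M) atTop (𝓝 0) := by
    have := ENNReal.Tendsto.const_mul (a := (n : ℝ≥0∞) ^ 3) ENNReal.tendsto_inv_nat_nhds_zero
      (Or.inr (by finiteness))
    simpa [div_eq_mul_inv] using this
  exact le_antisymm (ge_of_tendsto hlim ((eventually_gt_atTop 0).mono hbound)) zero_le

lemma ae_injective_fst (hX : IsPoissonProcess X leb2 P) :
    ∀ᵐ ω ∂P, Function.Injective fun i => (X i ω).1 := by
  refine ae_injective_of_strip hX measurable_fst (fun p => le_max_left _ _) fun n a b => ?_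
  refine (measure_mono (t := Set.Ico a b ×ˢ Set.Ico 0 (n : ℝ≥0)) ?_).trans ?_
  · rintro p ⟨⟨-, h⟩, h'⟩
    exact ⟨h', zero_le, h⟩
  · rw [leb2, Measure.prod_prod, leb_Ico, leb_Ico, mul_comm]
    simp

lemma ae_injective_snd (hX : IsPoissonProcess X leb2 P) :
    ∀ᵐ ω ∂P, Function.Injective fun i => (X i ω).2 := by
  refine ae_injective_of_strip hX measurable_snd (fun p => le_max_right _ _) fun n a b => ?_
  refine (measure_mono (t := Set.Ico 0 (n : ℝ≥0) ×ˢ Set.Ico a b) ?_).trans ?_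
  · rintro p ⟨⟨h, -⟩, h'⟩
    exact ⟨⟨zero_le, h⟩, h'⟩
  · rw [leb2, Measure.prod_prod, leb_Ico, leb_Ico]
    simp

end Distinct

/-! ### What the graphex conditions say about `f` -/

section Separable

variable {f : ℝ≥0 → ℝ}

lemma separable_mul_mem_Icc (hW : IsGraphex (separable f)) {a b : ℝ≥0} (hab : a ≠ b) :
    f a * f b ∈ Set.Icc (0 : ℝ) 1 := by
  simpa [separable, hab] using hW.mem_Icc a b

/-- Off the point `y`, `f` is a section of the kernel divided by `f y`. -/
lemma measurable_of_isGraphex_separable (hW : IsGraphex (separable f)) {y : ℝ≥0} (hy : f y ≠ 0) :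
    Measurable f := by
  classical
  have h1 : Measurable fun x => separable f x y / f y :=
    (hW.measurable.comp (measurable_id.prodMk measurable_const)).div_const _
  have h2 : f = fun x => if x = y then f y else separable f x y / f y := by
    ext x
    by_cases hx : x = y
    · simp [hx]
    · simp [separable, hx, hy]
  rw [h2]
  exact Measurable.ite (measurableSet_singleton y) measurable_const h1

lemma marginal_separable (hW : IsGraphex (separable f)) (hf : Measurable f) (x : ℝ≥0) :
    marginal (separable f) x =
      ENNReal.ofReal |f x| * ∫⁻ y, ENNReal.ofReal |f y| ∂leb := by
  rw [marginal, ← lintegral_const_mul _ (by fun_prop)]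
  have hne : ∀ᵐ y ∂leb, y ≠ x := by
    rw [ae_iff]; simp
  refine lintegral_congr_ae (hne.mono fun y hy => ?_)
  simp only
  rw [← ENNReal.ofReal_mul (abs_nonneg _), ← abs_mul,
    abs_of_nonneg (separable_mul_mem_Icc hW hy.symm).1, separable, if_neg hy.symm]

/-- Were the integral infinite, the marginal would be infinite wherever `f` is nonzero, a set of
positive measure. -/
lemma lintegral_abs_lt_top (hW : IsGraphex (separable f)) (hf : Measurable f)
    (hf0 : ¬ ∀ᵐ x ∂leb, f x = 0) : ∫⁻ y, ENNReal.ofReal |f y| ∂leb < ⊤ := by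
  by_contra h
  rw [not_lt, top_le_iff] at h
  refine hf0 (measure_mono_null (fun x hx => ?_) hW.marginal_top)
  have hx' : f x ≠ 0 := hx
  rw [Set.mem_ofPred_eq, marginal_separable hW hf, h]
  exact ENNReal.mul_top (by simpa using hx')

lemma exists_level (hf0 : ¬ ∀ᵐ x ∂leb, f x = 0) :
    ∃ δ : ℝ, 0 < δ ∧ 0 < leb {x | δ ≤ |f x|} := by
  by_contra! h
  refine hf0 (measure_mono_null (t := ⋃ n : ℕ, {x | 1 / ((n : ℝ) + 1) ≤ |f x|}) (fun x hx => ?_)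
    (measure_iUnion_null fun n => ?_))
  · obtain ⟨n, hn⟩ := exists_nat_one_div_lt (abs_pos.2 hx)
    exact Set.mem_iUnion.2 ⟨n, hn.le⟩
  · simpa using h (1 / ((n : ℝ) + 1)) (by positivity)

lemma leb_level_lt_top (hf : Measurable f) (hI : ∫⁻ y, ENNReal.ofReal |f y| ∂leb < ⊤) {δ : ℝ}
    (hδ : 0 < δ) : leb {x | δ ≤ |f x|} < ⊤ := by
  refine (measure_mono fun x (hx : δ ≤ |f x|) => ?_).trans_lt
    ((meas_ge_le_lintegral_div (f := fun y => ENNReal.ofReal |f y|) (by fun_prop)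
      (ε := ENNReal.ofReal δ) (by simpa using hδ) ENNReal.ofReal_ne_top).trans_lt
      (ENNReal.div_lt_top hI.ne (by simpa using hδ)))
  exact ENNReal.ofReal_le_ofReal hx

lemma exists_tail_lt (hf : Measurable f) (hI : ∫⁻ y, ENNReal.ofReal |f y| ∂leb < ⊤) {δ₀ : ℝ}
    (hδ₀ : 0 < δ₀) {κ : ℝ≥0∞} (hκ : 0 < κ) :
    ∃ δ, 0 < δ ∧ δ ≤ δ₀ ∧ ∫⁻ y in {y | |f y| < δ}, ENNReal.ofReal |f y| ∂leb < κ := by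
  have hmeas : ∀ n : ℕ, MeasurableSet {y | |f y| < 1 / ((n : ℝ) + 1)} := fun n =>
    measurableSet_lt hf.abs measurable_const
  have hlim : Tendsto (fun n : ℕ => ∫⁻ y, {y | |f y| < 1 / ((n : ℝ) + 1)}.indicator
      (fun y => ENNReal.ofReal |f y|) y ∂leb) atTop (𝓝 (∫⁻ _, 0 ∂leb)) := by
    refine tendsto_lintegral_of_dominated_convergence (fun y => ENNReal.ofReal |f y|)
      (fun n => (by fun_prop : Measurable fun y => ENNReal.ofReal |f y|).indicator (hmeas n))
      (fun n => ae_of_all _ fun y => Set.indicator_le_self _ _ _) hI.ne (ae_of_all _ fun y => ?_)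
    refine tendsto_const_nhds.congr' ?_
    by_cases hy : f y = 0
    · filter_upwards with n
      rw [Set.indicator_apply]
      simp [hy]
    · filter_upwards [tendsto_one_div_add_atTop_nhds_zero_nat.eventually_lt_const (abs_pos.2 hy)]
        with n hn
      rw [Set.indicator_of_notMem]
      simpa using hn.le
  rw [lintegral_zero] at hlim
  obtain ⟨n, hn, hn'⟩ := ((hlim.eventually_lt_const hκ).and
    (tendsto_one_div_add_atTop_nhds_zero_nat.eventually_lt_const hδ₀)).exists
  refine ⟨1 / ((n : ℝ) + 1), by positivity, hn'.le, ?_⟩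
  rwa [← lintegral_indicator (hmeas n)]

end Separable

lemma tendsto_core_error {δ : ℝ} (hδ : 0 < δ) :
    Tendsto (fun n : ℕ => (n : ℝ≥0∞) ^ 2 * ENNReal.ofReal (1 - δ ^ 4) ^ (n - 2) +
      ENNReal.ofReal (4 / n)) atTop (𝓝 0) := by
  -- `1 - δ ^ 4` may be zero or negative; the maximum with `1 / 2` keeps `q` positive, so that `q ^
  -- (n - 2) = q ^ n / q ^ 2`.
  set q : ℝ := max (1 - δ ^ 4) (1 / 2) with hq
  have hq0 : 0 < q := lt_of_lt_of_le (by norm_num) (le_max_right _ _)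
  have hq1 : q < 1 := max_lt (by have := pow_pos hδ 4; linarith) (by norm_num)
  have h1 : Tendsto (fun n : ℕ => (n : ℝ) ^ 2 * q ^ n / q ^ 2 + 4 / n) atTop (𝓝 0) := by
    have := (tendsto_pow_const_mul_const_pow_of_abs_lt_one 2
      (by rwa [abs_of_pos hq0] : |q| < 1)).div_const (q ^ 2)
    simpa using this.add (tendsto_const_div_atTop_nhds_zero_nat 4)
  have h2 := ENNReal.tendsto_ofReal h1
  rw [ENNReal.ofReal_zero] at h2
  refine tendsto_of_tendsto_of_tendsto_of_le_of_le' tendsto_const_nhds h2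
    (Eventually.of_forall fun _ => zero_le) ?_
  filter_upwards [eventually_ge_atTop 2] with n hn
  rw [ENNReal.ofReal_add (by positivity) (by positivity)]
  gcongr
  have hpow : q ^ n / q ^ 2 = q ^ (n - 2) := by
    rw [div_eq_iff (by positivity), ← pow_add, Nat.sub_add_cancel hn]
  rw [mul_div_assoc, hpow, ENNReal.ofReal_mul (by positivity), ENNReal.ofReal_pow hq0.le,
    ENNReal.ofReal_pow (by positivity), ENNReal.ofReal_natCast]
  gcongr
  exact le_max_left _ _

/-! ### Measurability of the typical event, needed to integrate out the points -/

section Measurability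

variable {f : ℝ≥0 → ℝ}

lemma measurable_weight (hf : Measurable f) (ν : ℝ≥0) : Measurable (weight f ν) := by
  classical
  exact Measurable.ite (measurableSet_le measurable_fst measurable_const)
    (hf.comp measurable_snd).abs measurable_const

lemma measurableSet_typical (hf : Measurable f) (ν : ℝ≥0) (δ ε : ℝ) :
    MeasurableSet {p : (ℕ → ℝ≥0 × ℝ≥0) × (Sym2 ℕ → ℝ) |
      Typical (fun i => weight f ν (p.1 i)) δ ε p.2} := by
  have hw : ∀ i, Measurable fun p : (ℕ → ℝ≥0 × ℝ≥0) × (Sym2 ℕ → ℝ) => weight f ν (p.1 i) :=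
    fun i => (measurable_weight hf ν).comp ((measurable_pi_apply i).comp measurable_fst)
  have hc : ∀ i, Measurable fun p : (ℕ → ℝ≥0 × ℝ≥0) × (Sym2 ℕ → ℝ) =>
      i ∈ core (fun i => weight f ν (p.1 i)) δ := fun i =>
    measurableSet_setOfPred.1 (measurableSet_le measurable_const (hw i))
  have ha : ∀ i j, Measurable fun p : (ℕ → ℝ≥0 × ℝ≥0) × (Sym2 ℕ → ℝ) =>
      Adj (fun i => weight f ν (p.1 i)) p.2 i j := fun i j =>
    measurable_const.and (measurableSet_setOfPred.1 (measurableSet_lt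
      ((measurable_pi_apply _).comp measurable_snd) ((hw i).mul (hw j))))
  have h1 := measurable_encard fun i => measurableSet_setOfPred.2 (hc i)
  have h2 : Measurable fun p : (ℕ → ℝ≥0 × ℝ≥0) × (Sym2 ℕ → ℝ) =>
      ((attached (fun i => weight f ν (p.1 i)) δ p.2).encard : ℝ≥0∞) := by
    refine measurable_encard fun i => ?_
    simp only [attached, Set.mem_ofPred_eq, measurableSet_setOfPred]
    fun_prop
  have h3 : Measurable fun p : (ℕ → ℝ≥0 × ℝ≥0) × (Sym2 ℕ → ℝ) =>
      ((stray (fun i => weight f ν (p.1 i)) δ p.2).encard : ℝ≥0∞) := by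
    refine measurable_encard fun i => ?_
    simp only [stray, Set.mem_ofPred_eq, measurableSet_setOfPred]
    fun_prop
  refine MeasurableSet.inter ?_ (MeasurableSet.inter (measurableSet_lt h2 measurable_const)
    (measurableSet_le h3 ((h1.add h2).const_mul _)))
  change MeasurableSet {p : (ℕ → ℝ≥0 × ℝ≥0) × (Sym2 ℕ → ℝ) |
    CoreLinked (fun i => weight f ν (p.1 i)) δ p.2}
  simp only [CoreLinked, measurableSet_setOfPred]
  fun_prop

end Measurability

/-! ### Integrating out the latent points -/

section Main

variable {Ω : Type*} [MeasurableSpace Ω] {P : Measure Ω} {X : ℕ → Ω → ℝ≥0 × ℝ≥0}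
  {ζ : Sym2 ℕ → Ω → ℝ} {f : ℝ≥0 → ℝ}

lemma IsLatent.uniformEdges (h : IsLatent X ζ P) : UniformEdges ζ P :=
  ⟨h.measurable, h.uniform, h.iIndep⟩

lemma IsLatent.ae_nonneg (h : IsLatent X ζ P) : ∀ᵐ ω ∂P, ∀ e, 0 ≤ ζ e ω := by
  rw [ae_all_iff]
  intro e
  rw [ae_iff]
  simpa using measure_edge_lt h.uniform e zero_le_one

/-- The latent points and the edge variables can be integrated out separately. -/
lemma IsLatent.measure_eq_lintegral [IsProbabilityMeasure P] (h : IsLatent X ζ P)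
    {S : Set ((ℕ → ℝ≥0 × ℝ≥0) × (Sym2 ℕ → ℝ))} (hS : MeasurableSet S) :
    P {ω | ((fun i => X i ω), fun e => ζ e ω) ∈ S} =
      ∫⁻ ω, P {ω' | ((fun i => X i ω), fun e => ζ e ω') ∈ S} ∂P := by
  have hXm : Measurable fun ω i => X i ω := measurable_pi_lambda _ h.poisson.measurable
  have hζm : Measurable fun ω e => ζ e ω := measurable_pi_lambda _ h.measurable
  have hprod := (indepFun_iff_map_prod_eq_prod_map_map hXm.aemeasurable hζm.aemeasurable).1 h.indep
  have h1 : P {ω | ((fun i => X i ω), fun e => ζ e ω) ∈ S} =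
      P.map (fun ω => ((fun i => X i ω), fun e => ζ e ω)) S :=
    (Measure.map_apply (hXm.prodMk hζm) hS).symm
  have := Measure.isProbabilityMeasure_map hζm.aemeasurable (μ := P)
  rw [h1, hprod, Measure.prod_apply hS, lintegral_map (measurable_measure_prodMk_left hS) hXm]
  refine lintegral_congr fun ω => ?_
  exact Measure.map_apply hζm (measurable_prodMk_left hS)

/-- The event that the latent points are in general position, and that the core contains at least
`n` points and all but a small fraction of the weight. -/
def GoodPoints (f : ℝ≥0 → ℝ) (ν : ℝ≥0) (δ η : ℝ) (n : ℕ) (x : ℕ → ℝ≥0 × ℝ≥0) : Prop :=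
  (Function.Injective fun i => (x i).1) ∧ (Function.Injective fun i => (x i).2) ∧
    ∃ K : Finset ℕ, (∀ i, i ∈ K ↔ δ ≤ weight f ν (x i)) ∧ n ≤ K.card ∧
      outerWeight (fun i => weight f ν (x i)) δ ≤
        ENNReal.ofReal (η * ∑ i ∈ K, weight f ν (x i))

/-- The level `δ₀` is fixed before `δ`: it bounds the core weight from below by `δ₀ * ν * a / 2`,
however small `δ` is. The mean outer weight is `ν` times the tail integral of `|f|`, so `ν` cancels
in Markov's inequality. -/
lemma measure_not_goodPoints_le (hX : IsPoissonProcess X leb2 P) (hf : Measurable f)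
    (hI : ∫⁻ y, ENNReal.ofReal |f y| ∂leb < ⊤) {δ₀ δ η : ℝ} (hδ : 0 < δ) (hδ₀ : δ ≤ δ₀)
    (hη : 0 < η) {ν : ℝ≥0} (hν : 0 < ν) {n : ℕ} {a : ℝ} (ha : 0 < a)
    (hlev : leb {x | δ₀ ≤ |f x|} = ENNReal.ofReal a) (hn : n ≤ ν * a / 2) :
    P {ω | ¬ GoodPoints f ν δ η n (fun i => X i ω)} ≤
      ENNReal.ofReal (Real.exp (-(ν * a / 8))) +
        (∫⁻ y in {y | |f y| < δ}, ENNReal.ofReal |f y| ∂leb) /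
          ENNReal.ofReal (η * δ₀ * a / 2) := by
  set A₀ : Set (ℝ≥0 × ℝ≥0) := Set.Iic ν ×ˢ {x | δ₀ ≤ |f x|} with hA₀
  set A : Set (ℝ≥0 × ℝ≥0) := Set.Iic ν ×ˢ {x | δ ≤ |f x|} with hA
  have hlevm : ∀ t : ℝ, MeasurableSet {x | t ≤ |f x|} := fun t =>
    measurableSet_le measurable_const hf.abs
  have hA₀m : MeasurableSet A₀ := measurableSet_Iic.prod (hlevm _)
  have hAm : MeasurableSet A := measurableSet_Iic.prod (hlevm _)
  have hmA₀ : leb2 A₀ = ENNReal.ofReal (ν * a) := by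
    rw [hA₀, leb2, Measure.prod_prod, leb_Iic, hlev, ENNReal.ofReal_mul ν.coe_nonneg,
      ENNReal.ofReal_coe_nnreal]
  have hmA : leb2 A < ⊤ := by
    rw [hA, leb2, Measure.prod_prod, leb_Iic]
    exact ENNReal.mul_lt_top ENNReal.coe_lt_top (leb_level_lt_top hf hI hδ)
  have hcoreA : ∀ x : ℕ → ℝ≥0 × ℝ≥0, core (fun i => weight f ν (x i)) δ = {i | x i ∈ A} := by
    intro x
    ext i
    by_cases h : (x i).1 ≤ ν <;> simp [core, weight, hA, h, hδ]
  set φ : ℝ≥0 × ℝ≥0 → ℝ≥0∞ :=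
    (Set.Iic ν ×ˢ {x | |f x| < δ}).indicator fun p => ENNReal.ofReal |f p.2| with hφ
  have htailm : MeasurableSet {x | |f x| < δ} := measurableSet_lt hf.abs measurable_const
  have hφm : Measurable φ :=
    Measurable.indicator (by fun_prop) (measurableSet_Iic.prod htailm)
  have houter : ∀ x : ℕ → ℝ≥0 × ℝ≥0,
      outerWeight (fun i => weight f ν (x i)) δ = ∑' i, φ (x i) := by
    intro x
    refine tsum_congr fun i => ?_
    by_cases h : (x i).1 ≤ ν <;> by_cases h' : |f (x i).2| < δ <;>
      simp [core, weight, hφ, h, h', not_le, hδ, not_lt.1]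
  have hmean : ∫⁻ ω, ∑' i, φ (X i ω) ∂P =
      ν * ∫⁻ y in {y | |f y| < δ}, ENNReal.ofReal |f y| ∂leb := by
    have h2 : SigmaFinite leb2 := by unfold leb2; infer_instance
    rw [hX.lintegral_tsum hφm, hφ, lintegral_indicator (measurableSet_Iic.prod htailm), leb2,
      ← Measure.prod_restrict, lintegral_prod _ (by fun_prop)]
    simp [leb_Iic, mul_comm]
  have hcov : {ω | ¬ GoodPoints f ν δ η n (fun i => X i ω)} ⊆
      (({ω | ¬ Function.Injective fun i => (X i ω).1} ∪
        {ω | ¬ Function.Injective fun i => (X i ω).2}) ∪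
        {ω | ¬ ((count (fun i => X i ω) A : ℕ∞) : ℝ≥0∞) < ⊤}) ∪
      ({ω | (count (fun i => X i ω) A₀ : ℝ≥0∞) < leb2 A₀ / 2} ∪
        {ω | ENNReal.ofReal (ν * (η * δ₀ * a / 2)) ≤ ∑' i, φ (X i ω)}) := by
    intro ω hω
    by_contra hcon
    simp only [Set.mem_union, Set.mem_ofPred_eq, not_or, not_not, not_lt, not_le] at hcon
    obtain ⟨⟨⟨c1, c2⟩, c3⟩, c4, c5⟩ := hcon
    have hfin : {i | X i ω ∈ A}.Finite := by
      rw [← Set.encard_lt_top_iff]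
      exact ENat.toENNReal_lt_top.1 c3
    have hKmem : ∀ i, i ∈ hfin.toFinset ↔ δ ≤ weight f ν (X i ω) := by
      intro i
      rw [Set.Finite.mem_toFinset, ← hcoreA fun i => X i ω]
      rfl
    have hsub : {i | X i ω ∈ A₀} ⊆ {i | X i ω ∈ A} := fun i hi => ⟨hi.1, hδ₀.trans hi.2⟩
    have hfin₀ : {i | X i ω ∈ A₀}.Finite := hfin.subset hsub
    have hcard : ν * a / 2 ≤ (hfin₀.toFinset.card : ℝ) := by
      rw [count, hfin₀.encard_eq_coe_toFinset_card, hmA₀, ENat.toENNReal_coe] at c4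
      have := ENNReal.toReal_mono (by finiteness) c4
      rwa [ENNReal.toReal_div, ENNReal.toReal_ofReal (by positivity)] at this
    have hsub' : hfin₀.toFinset ⊆ hfin.toFinset := by simpa using hsub
    refine hω ⟨c1, c2, hfin.toFinset, hKmem, ?_, ?_⟩
    · have : (n : ℝ) ≤ hfin.toFinset.card :=
        (hn.trans hcard).trans (by exact_mod_cast Finset.card_le_card hsub')
      exact_mod_cast this
    · rw [houter]
      refine c5.le.trans (ENNReal.ofReal_le_ofReal ?_)
      have hS : (hfin₀.toFinset.card : ℝ) * δ₀ ≤ ∑ i ∈ hfin.toFinset, weight f ν (X i ω) := by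
        rw [← nsmul_eq_mul]
        refine (Finset.card_nsmul_le_sum _ _ _ fun i hi => ?_).trans
          (Finset.sum_le_sum_of_subset_of_nonneg hsub' fun i _ _ => weight_nonneg _ _ _)
        obtain ⟨h1, h2⟩ : X i ω ∈ A₀ := by simpa using hi
        rw [weight, if_pos (Set.mem_Iic.1 h1)]
        exact h2
      have h3 := mul_le_mul_of_nonneg_right hcard (hδ.le.trans hδ₀)
      nlinarith [mul_le_mul_of_nonneg_left (h3.trans hS) hη.le]
  refine (measure_mono hcov).trans ((measure_union_le _ _).trans ?_)
  have hzero : P (({ω | ¬ Function.Injective fun i => (X i ω).1} ∪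
        {ω | ¬ Function.Injective fun i => (X i ω).2}) ∪
        {ω | ¬ ((count (fun i => X i ω) A : ℕ∞) : ℝ≥0∞) < ⊤}) = 0 := by
    refine measure_union_null (measure_union_null (ae_injective_fst hX) (ae_injective_snd hX)) ?_
    refine ae_lt_top (measurable_encard fun i => hX.measurable i hAm) ?_
    have := hX.lintegral_count hAm hmA
    exact (this.trans_lt hmA).ne
  rw [hzero, zero_add]
  refine (measure_union_le _ _).trans (add_le_add ?_ ?_)
  · refine (hX.measure_count_lt_le hA₀m (hmA₀ ▸ ENNReal.ofReal_lt_top)).trans (le_of_eq ?_)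
    rw [hmA₀, ENNReal.toReal_ofReal (by positivity)]
  · have hpos : 0 < η * δ₀ * a / 2 := by
      have := hδ.trans_le hδ₀
      positivity
    have hm : Measurable fun ω => ∑' i, φ (X i ω) :=
      Measurable.tsum fun i => hφm.comp (hX.measurable i)
    refine (meas_ge_le_lintegral_div hm.aemeasurable
      (ENNReal.ofReal_pos.2 (mul_pos (NNReal.coe_pos.2 hν) hpos)).ne' ENNReal.ofReal_ne_top).trans (le_of_eq ?_)
    rw [hmean, ENNReal.ofReal_mul ν.coe_nonneg, ENNReal.ofReal_coe_nnreal]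
    exact ENNReal.mul_div_mul_left _ _ (by simpa using hν.ne') ENNReal.coe_ne_top

/-- Bad points are counted twice: in bounding the atypical event and in applying `giant_of_typical`.
-/
theorem measure_not_giant_le [IsProbabilityMeasure P] (hX : IsLatent X ζ P)
    (hW : IsGraphex (separable f)) (hf : Measurable f) {δ η ε : ℝ} (hδ : 0 < δ) (hη : 0 ≤ η)
    (hε : 0 < ε) (ν : ℝ≥0) {n : ℕ} (hn : 2 ≤ n) {c : ℝ≥0∞}
    (hc : ∀ k ≥ n, (k : ℝ≥0∞) ^ 2 * ENNReal.ofReal (1 - δ ^ 4) ^ (k - 2) +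
      ENNReal.ofReal (4 / k) ≤ c) :
    P {ω | ¬ ((vertexSet (separable f) (fun i => X i ω) (fun e => ζ e ω) ν).Finite ∧
        (1 - ε) * ((vertexSet (separable f) (fun i => X i ω) (fun e => ζ e ω) ν).ncard : ℝ)
          < ((largestComponentSize
              (graph (separable f) (fun i => X i ω) (fun e => ζ e ω) ν)).toNat : ℝ))} ≤
      c + ENNReal.ofReal (4 * η / ε) +
        2 * P {ω | ¬ GoodPoints f ν δ η n (fun i => X i ω)} := by
  set B := {ω | ¬ GoodPoints f ν δ η n (fun i => X i ω)} with hB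
  have hcov : {ω | ¬ ((vertexSet (separable f) (fun i => X i ω) (fun e => ζ e ω) ν).Finite ∧
        (1 - ε) * ((vertexSet (separable f) (fun i => X i ω) (fun e => ζ e ω) ν).ncard : ℝ)
          < ((largestComponentSize
              (graph (separable f) (fun i => X i ω) (fun e => ζ e ω) ν)).toNat : ℝ))} ⊆
      ({ω | ¬ Typical (fun i => weight f ν (X i ω)) δ ε fun e => ζ e ω} ∪ B) ∪
        {ω | ¬ ∀ e, 0 ≤ ζ e ω} := by
    intro ω hω
    by_contra hcon
    simp only [hB, Set.mem_union, Set.mem_ofPred_eq, not_or, not_not] at hcon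
    obtain ⟨⟨ht, h1, h2, K, hK, hcard, -⟩, hz⟩ := hcon
    have hKc : core (fun i => weight f ν (X i ω)) δ = (K : Set ℕ) := by
      ext i; simp [core, hK]
    refine hω (giant_of_typical (fun a b hab => (separable_mul_mem_Icc hW hab).1) h1 h2 hz hε ?_ ?_
      ht)
    · rw [hKc]; exact K.finite_toSet
    · rw [hKc, Set.ncard_coe_finset]; omega
  have htyp : P {ω | ¬ Typical (fun i => weight f ν (X i ω)) δ ε fun e => ζ e ω} ≤
      c + ENNReal.ofReal (4 * η / ε) + P B := by
    refine (hX.measure_eq_lintegral (measurableSet_typical hf ν δ ε).compl).trans_le ?_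
    -- `B` is not shown to be measurable, so its measurable hull is used, on which the inner
    -- probability is bounded by `1`.
    calc _ ≤ ∫⁻ ω, ((c + ENNReal.ofReal (4 * η / ε)) + (toMeasurable P B).indicator 1 ω) ∂P := by
          refine lintegral_mono fun ω => ?_
          by_cases hω : ω ∈ B
          · rw [Set.indicator_of_mem (subset_toMeasurable P B hω)]
            exact prob_le_one.trans le_add_self
          · refine le_trans ?_ le_self_add
            simp only [hB, Set.mem_ofPred_eq, not_not] at hω
            obtain ⟨-, h2, K, hK, hcard, hO⟩ := hω
            have hle : ∀ i j, i ≠ j → weight f ν (X i ω) * weight f ν (X j ω) ≤ 1 := by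
              intro i j hij
              have := (separable_mul_mem_Icc hW fun h => hij (h2 h)).2
              have := (separable_mul_mem_Icc hW fun h => hij (h2 h)).1
              unfold weight
              split_ifs
              · rw [← abs_mul, abs_of_nonneg] <;> assumption
              all_goals simp
            refine (measure_not_typical_le hX.uniformEdges (fun i => weight_nonneg _ _ _) hle hδ hK
              (Finset.card_pos.1 (by omega)) hη hε hO).trans ?_
            gcongr
            exact hc _ hcard
      _ = c + ENNReal.ofReal (4 * η / ε) + P B := by
          rw [lintegral_add_left measurable_const,
            lintegral_indicator_one (measurableSet_toMeasurable _ _), measure_toMeasurable]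
          simp
  refine (measure_mono hcov).trans ((measure_union_le _ _).trans ?_)
  rw [show P {ω | ¬ ∀ e, 0 ≤ ζ e ω} = 0 from hX.ae_nonneg, add_zero]
  refine (measure_union_le _ _).trans ((add_le_add_left htyp _).trans (le_of_eq ?_))
  ring

end Main

end KEG

/-! ### Choice of the parameters and the limit -/

theorem mainTheorem8 {Ω : Type*} [MeasurableSpace Ω] (P : Measure Ω) [IsProbabilityMeasure P]
    (X : ℕ → Ω → ℝ≥0 × ℝ≥0) (ζ : Sym2 ℕ → Ω → ℝ) (hX : KEG.IsLatent X ζ P)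
    (f : ℝ≥0 → ℝ) (hW : KEG.IsGraphex (KEG.separable f))
    (hf : ¬ ∀ᵐ x ∂KEG.leb, f x = 0)
    (ε : ℝ) (hε : 0 < ε) :
    Tendsto
      (fun ν : ℝ≥0 => P {ω |
        (KEG.vertexSet (KEG.separable f) (fun i => X i ω) (fun e => ζ e ω) ν).Finite ∧
        (1 - ε) *
            ((KEG.vertexSet (KEG.separable f) (fun i => X i ω) (fun e => ζ e ω) ν).ncard : ℝ)
          < ((KEG.largestComponentSize
              (KEG.graph (KEG.separable f) (fun i => X i ω) (fun e => ζ e ω) ν)).toNat : ℝ)})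
      atTop (𝓝 1) := by
  obtain ⟨y, hy⟩ : ∃ y, f y ≠ 0 := by
    by_contra! h
    exact hf (ae_of_all _ h)
  have hfm : Measurable f := KEG.measurable_of_isGraphex_separable hW hy
  have hI := KEG.lintegral_abs_lt_top hW hfm hf
  obtain ⟨δ₀, hδ₀, hlev⟩ := KEG.exists_level hf
  have hlevtop := KEG.leb_level_lt_top hfm hI hδ₀
  set a : ℝ := (KEG.leb {x | δ₀ ≤ |f x|}).toReal with ha
  have ha0 : 0 < a := ENNReal.toReal_pos hlev.ne' hlevtop.ne
  have hlev' : KEG.leb {x | δ₀ ≤ |f x|} = ENNReal.ofReal a :=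
    (ENNReal.ofReal_toReal hlevtop.ne).symm
  set E : ℝ≥0 → Set Ω := fun ν => {ω |
        (KEG.vertexSet (KEG.separable f) (fun i => X i ω) (fun e => ζ e ω) ν).Finite ∧
        (1 - ε) *
            ((KEG.vertexSet (KEG.separable f) (fun i => X i ω) (fun e => ζ e ω) ν).ncard : ℝ)
          < ((KEG.largestComponentSize
              (KEG.graph (KEG.separable f) (fun i => X i ω) (fun e => ζ e ω) ν)).toNat : ℝ)}
  have hcompl : Tendsto (fun ν => P (E ν)ᶜ) atTop (𝓝 0) := by
    rw [ENNReal.tendsto_nhds_zero]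
    intro ρ hρ
    obtain ⟨r', hr', hrρ⟩ := ENNReal.lt_iff_exists_nnreal_btwn.1 hρ
    set r : ℝ := (r' : ℝ) with hr
    have hr0 : 0 < r := by simpa [hr] using hr'
    -- This makes `4 * η / ε = r / 4`. The core error takes another `r / 4`, and the bad points
    -- twice `r / 8 + r / 8`.
    set η : ℝ := r * ε / 16 with hη
    have hη0 : 0 < η := by positivity
    obtain ⟨δ, hδ, hδδ₀, htail⟩ := KEG.exists_tail_lt hfm hI hδ₀
      (κ := ENNReal.ofReal (r / 8) * ENNReal.ofReal (η * δ₀ * a / 2))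
      (ENNReal.mul_pos (by simpa using hr0)
        (ENNReal.ofReal_pos.2 (by positivity : 0 < η * δ₀ * a / 2)).ne')
    obtain ⟨n, hn⟩ := eventually_atTop.1 ((KEG.tendsto_core_error hδ).eventually_le_const
      (ENNReal.ofReal_pos.2 (by positivity : 0 < r / 4)))
    have hlim : Tendsto (fun ν : ℝ≥0 => (ν : ℝ) * a) atTop atTop :=
      (NNReal.tendsto_coe_atTop.2 tendsto_id).atTop_mul_const ha0
    have hexp : Tendsto (fun ν : ℝ≥0 => Real.exp (-(ν * a / 8))) atTop (𝓝 0) :=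
      Real.tendsto_exp_neg_atTop_nhds_zero.comp (hlim.atTop_div_const (by norm_num))
    filter_upwards [eventually_gt_atTop 0,
      (hlim.atTop_div_const (by norm_num : (0 : ℝ) < 2)).eventually_ge_atTop ((max n 2 : ℕ) : ℝ),
      hexp.eventually_le_const (by positivity : 0 < r / 8)] with ν hν hνn hνexp
    have hgiant := KEG.measure_not_giant_le hX hW hfm hδ hη0.le hε ν (n := max n 2)
      (le_max_right _ _) (c := ENNReal.ofReal (r / 4))
      fun k hk => hn k ((le_max_left _ _).trans hk)
    have hgood := KEG.measure_not_goodPoints_le hX.poisson hfm hI hδ hδδ₀ hη0 hν ha0 hlev' hνn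
    have hgood' : P {ω | ¬ KEG.GoodPoints f ν δ η (max n 2) fun i => X i ω} ≤
        ENNReal.ofReal (r / 8) + ENNReal.ofReal (r / 8) := by
      refine hgood.trans (add_le_add (ENNReal.ofReal_le_ofReal hνexp) ?_)
      exact ENNReal.div_le_of_le_mul htail.le
    refine (hgiant.trans ?_).trans hrρ.le
    have h4 : 4 * η / ε = r / 4 := by rw [hη]; field_simp; norm_num
    calc _ ≤ ENNReal.ofReal (r / 4) + ENNReal.ofReal (4 * η / ε) +
          2 * (ENNReal.ofReal (r / 8) + ENNReal.ofReal (r / 8)) := by gcongr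
      _ = ENNReal.ofReal r := by
          rw [h4, ← ENNReal.ofReal_add (by positivity) (by positivity),
            ← ENNReal.ofReal_add (by positivity) (by positivity),
            ← ENNReal.ofReal_ofNat, ← ENNReal.ofReal_mul (by positivity),
            ← ENNReal.ofReal_add (by positivity) (by positivity)]
          congr 1
          ring
      _ = r' := by rw [hr, ENNReal.ofReal_coe_nnreal]
  -- `E ν` is not shown to be measurable, so the passage from the complement uses only
  -- subadditivity.
  have hsub : Tendsto (fun ν => 1 - P (E ν)ᶜ) atTop (𝓝 1) := by
    simpa using ENNReal.Tendsto.sub tendsto_const_nhds hcompl (Or.inl ENNReal.one_ne_top)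
  refine tendsto_of_tendsto_of_tendsto_of_le_of_le hsub tendsto_const_nhds (fun ν => ?_)
    fun ν => prob_le_one
  rw [tsub_le_iff_right]
  calc (1 : ℝ≥0∞) = P (E ν ∪ (E ν)ᶜ) := by rw [Set.union_compl_self, measure_univ]
    _ ≤ _ := measure_union_le _ _
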